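/- Let $d\ge 1$. For a Lebesgue measurable set $E\subset\mathbb{R}^d$ let $P(E)=\sup\{-\int_E \operatorname{div}\xi\,dx:\ \xi\in C^1_c(\mathbb{R}^d;\mathbb{R}^d),\ |\xi|\le 1\}$ be its perimeter, and let $$W_2^2(\chi_E,\chi_F)=\inf_\gamma \iint |x-y|^2\,d\gamma(x,y),$$ where the infimum is over all finite measures $\gamma$ on $\mathbb{R}^d\times\mathbb{R}^d$ with marginals $\chi_E(x)\,dx$ and $\chi_F(y)\,dy$ (it is $+\infty$ if there are none). Let $k:\mathbb{R}^d\to[0,\infty)$ be integrable with $k(-z)=k(z)$ and $\int k=1$, and set $\mathcal{E}(E)=P(E)+\int_E k*\chi_E\,dx$. Let $E_0\subset\mathbb{R}^d$ be Lebesgue measurable with $P(E_0)<\infty$ and $\int_{E_0}(1+|x|^2)\,dx<\infty$. For a time step $h>0$ let the measurable sets $E_1,E_2,\dots$ be such that, for each $n\ge1$, $E_n$ minimizes $$E\mapsto \frac1{2h}W_2^2(\chi_E,\chi_{E_{n-1}})+P(E)+\int_E k*\chi_E\,dx$$ among all Lebesgue measurable sets $E\subset\mathbb{R}^d$, and put $E_h(t)=E_{\lfloor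 t/h\rfloor}$ for $t\ge0$. **Lemma (Compactness).** There is a constant $C=C(d)$, depending only on $d$, such that for all such $k$, $E_0$ the following holds. (i) For every $h>0$, every discrete solution $E_h$ as above and all $t>s\ge0$ with $t-s\ge h$, $$W_2(\chi_{E_h(t)},\chi_{E_h(s)})\le C\,\mathcal{E}(E_0)^{1/2}(t-s)^{1/2},\qquad |E_h(t)\triangle E_h(s)|\le C\,|E_0|^{1/4}\,\mathcal{E}(E_0)^{3/4}(t-s)^{1/4}.$$ (ii) For every sequence of time steps $h_j>0$ with $h_j\to0$ and discrete solutions $E_{h_j}$ as above, there are a subsequence (not relabelled) and a family $(E(t))_{t\ge0}$ of sets of finite perimeter such that, for every $T<\infty$, $$\sup_{t\in[0,T]}|E_{h_j}(t)\triangle E(t)|\to0\quad\text{as } j\to\infty,$$ and, for all $t>s\ge0$, $$W_2(\chi_{E(t)},\chi_{E(s)})\le C\,\mathcal{E}(E_0)^{1/2}(t-s)^{1/2},\qquad |E(t)\triangle E(s)|\le C\,|E_0|^{1/4}\,\mathcal{E}(E_0)^{3/4}(t-s)^{1/4}.$$ In particular, under the normalization $|E_0|=1$ the factor $|E_0|^{1/4}$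 equals $1$. -/

import Mathlib

open MeasureTheory Filter Topology
open scoped ENNReal symmDiff

namespace FerroFlow

noncomputable section

/-- The divergence of a vector field on `ℝ^d`. -/
def divergence {d : ℕ} (ξ : EuclideanSpace ℝ (Fin d) → EuclideanSpace ℝ (Fin d))
    (x : EuclideanSpace ℝ (Fin d)) : ℝ :=
  ∑ i : Fin d, (fderiv ℝ ξ x (EuclideanSpace.single i 1)) i

/-- The perimeter `P(E) = sup { - ∫_E div ξ : ξ ∈ C_c^1(ℝ^d; ℝ^d), |ξ| ≤ 1 }`. -/
def perimeter {d : ℕ} (E : Set (EuclideanSpace ℝ (Fin d))) : ℝ≥0∞ :=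
  ⨆ (ξ : EuclideanSpace ℝ (Fin d) → EuclideanSpace ℝ (Fin d))
    (_ : ContDiff ℝ 1 ξ) (_ : HasCompactSupport ξ) (_ : ∀ x, ‖ξ x‖ ≤ 1),
    ENNReal.ofReal (-∫ x in E, divergence ξ x)

/-- A set of finite perimeter: Lebesgue measurable (that is, measurable for the completion of the
Borel σ-algebra with respect to `volume`) with finite perimeter. -/
def HasFinitePerimeter {d : ℕ} (E : Set (EuclideanSpace ℝ (Fin d))) : Prop :=
  NullMeasurableSet E volume ∧ perimeter E < ∞

/-- `γ` is a transport plan from `χ_E dx` to `χ_F dy`. -/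
def IsTransportPlan {d : ℕ} (E F : Set (EuclideanSpace ℝ (Fin d)))
    (γ : Measure (EuclideanSpace ℝ (Fin d) × EuclideanSpace ℝ (Fin d))) : Prop :=
  IsFiniteMeasure γ ∧ γ.map Prod.fst = volume.restrict E ∧ γ.map Prod.snd = volume.restrict F

/-- The squared Wasserstein distance `W_2²(χ_E, χ_F)`; it is `∞` if there is no transport plan. -/
def W2sq {d : ℕ} (E F : Set (EuclideanSpace ℝ (Fin d))) : ℝ≥0∞ :=
  ⨅ (γ : Measure (EuclideanSpace ℝ (Fin d) × EuclideanSpace ℝ (Fin d)))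
    (_ : IsTransportPlan E F γ), ∫⁻ p, ‖p.1 - p.2‖ₑ ^ 2 ∂γ

/-- The Wasserstein distance `W_2(χ_E, χ_F)`. -/
def W2 {d : ℕ} (E F : Set (EuclideanSpace ℝ (Fin d))) : ℝ≥0∞ :=
  W2sq E F ^ (1 / 2 : ℝ)

/-- A non-negative, symmetric, normalized convolution kernel. -/
structure IsKernel {d : ℕ} (k : EuclideanSpace ℝ (Fin d) → ℝ) : Prop where
  nonneg : ∀ z, 0 ≤ k z
  symm : ∀ z, k (-z) = k z
  integrable : Integrable k volume
  integral_eq_one : ∫ z, k z = 1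

/-- The convolution `k * χ_E` of a non-negative kernel with a characteristic function. -/
def convIndicator {d : ℕ} (k : EuclideanSpace ℝ (Fin d) → ℝ)
    (E : Set (EuclideanSpace ℝ (Fin d))) (x : EuclideanSpace ℝ (Fin d)) : ℝ≥0∞ :=
  ∫⁻ y in E, ENNReal.ofReal (k (x - y))

/-- The total energy `P(E) + ∫_E k * χ_E dx`. -/
def energy {d : ℕ} (k : EuclideanSpace ℝ (Fin d) → ℝ)
    (E : Set (EuclideanSpace ℝ (Fin d))) : ℝ≥0∞ :=
  perimeter E + ∫⁻ x in E, convIndicator k E x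

/-- The functional `E ↦ W_2²(χ_E, χ_F) / (2h) + P(E) + ∫_E k * χ_E dx`, where `F` is the
previous set. -/
def stepFunctional {d : ℕ} (k : EuclideanSpace ℝ (Fin d) → ℝ) (h : ℝ)
    (F E : Set (EuclideanSpace ℝ (Fin d))) : ℝ≥0∞ :=
  W2sq E F / ENNReal.ofReal (2 * h) + energy k E

/-- `E 0, E 1, E 2, …` is produced by the minimizing movements scheme with time step `h`
started at `E₀`: each `E (n + 1)` minimizes the step functional with previous set `E n`
among all Lebesgue measurable sets. -/
structure IsMinimizingMovement {d : ℕ} (k : EuclideanSpace ℝ (Fin d) → ℝ) (h : ℝ)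
    (E₀ : Set (EuclideanSpace ℝ (Fin d))) (E : ℕ → Set (EuclideanSpace ℝ (Fin d))) : Prop where
  init : E 0 = E₀
  measurable : ∀ n, NullMeasurableSet (E n) volume
  minimal : ∀ n, ∀ F : Set (EuclideanSpace ℝ (Fin d)), NullMeasurableSet F volume →
    stepFunctional k h (E n) (E (n + 1)) ≤ stepFunctional k h (E n) F

/-- The piecewise constant interpolation `E_h(t) = E_{[t/h]}`, for `t ≥ 0`. -/
def interpolate {d : ℕ} (h : ℝ) (E : ℕ → Set (EuclideanSpace ℝ (Fin d))) (t : ℝ) :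
    Set (EuclideanSpace ℝ (Fin d)) :=
  E ⌊t / h⌋₊

/-- Admissible initial conditions: `E₀` is Lebesgue measurable, `P(E₀) < ∞` and
`∫_{E₀} (1 + |x|²) dx < ∞`. -/
structure IsInitialCondition {d : ℕ} (E₀ : Set (EuclideanSpace ℝ (Fin d))) : Prop where
  measurable : NullMeasurableSet E₀ volume
  perimeter_lt_top : perimeter E₀ < ∞
  moment_lt_top : ∫⁻ x in E₀, ENNReal.ofReal (1 + ‖x‖ ^ 2) < ∞

end

end FerroFlow

namespace FerroFlow

/-! ### Flux and translation estimates from the perimeter -/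

section Perimeter

variable {d : ℕ}

/-! Discrete estimates. Comparing `E (n + 1)` with the competitor `E n`, whose transport cost is
zero, shows that the energy decreases and that the squared Wasserstein increments sum to at most
`2h` times the initial energy. The triangle inequality and Cauchy-Schwarz turn this into 1/2-Hölder
continuity in `W_2`, up to one extra time step (`IsMinimizingMovement.W2sq_le`). Volume is conserved
because a finite transport cost forces equal masses.

The `L^1` estimate interpolates between perimeter and `W_2` (`exists_measure_symmDiff_sq_le`).
Averaging a test function at scale `r` costs at most `r P` on each set. The average is `L /
r`-Lipschitz, so its integrals over `E` and `F` differ by at most `(L / r) |E|^{1/2} W_2`.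
Optimizing in `r` gives `|E ∆ F|² ≤ C P |E|^{1/2} W_2`, hence the exponent 1/4 in time. The constant
comes from a fixed mollifier, so it depends only on `d`.

Compactness. The same averaging reduces the Cauchy property in `L^1` to convergence of the volumes
inside the cells of fine partitions, second moments providing tightness
(`cauchy_symmDiff_of_tendsto_partition`). One subsequence serves all cells at all rational times,
and the Hölder estimate spreads the convergence uniformly over `[0, T]`.

The bounds pass to the limit by lower semicontinuity. For `W_2` no weak compactness of plans is
needed: a plan between approximating sets is repaired on the small mass where its marginals are
wrong, at a cost governed by second moments (`IsTransportPlan.W2sq_le_add`). -/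

theorem divergence_const_smul {ξ : EuclideanSpace ℝ (Fin d) → EuclideanSpace ℝ (Fin d)}
    (hξ : Differentiable ℝ ξ) (c : ℝ) (x : EuclideanSpace ℝ (Fin d)) :
    divergence (fun z => c • ξ z) x = c * divergence ξ x := by
  simp only [divergence, Finset.mul_sum]
  refine Finset.sum_congr rfl fun i _ => ?_
  rw [fderiv_fun_const_smul (hξ x)]
  simp

/-- The perimeter controls the flux of every `C_c^1` vector field. -/
theorem neg_setIntegral_divergence_le {A : Set (EuclideanSpace ℝ (Fin d))}
    (hA : perimeter A ≠ ∞) {ξ : EuclideanSpace ℝ (Fin d) → EuclideanSpace ℝ (Fin d)}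
    (hξ : ContDiff ℝ 1 ξ) (hc : HasCompactSupport ξ) {M : ℝ} (hM : 0 < M)
    (hξM : ∀ x, ‖ξ x‖ ≤ M) :
    -∫ x in A, divergence ξ x ≤ M * (perimeter A).toReal := by
  have hd : Differentiable ℝ ξ := hξ.differentiable one_ne_zero
  have h1 : ENNReal.ofReal (-∫ x in A, divergence (fun z => M⁻¹ • ξ z) x) ≤ perimeter A := by
    refine le_iSup_of_le (fun z => M⁻¹ • ξ z) (le_iSup_of_le (hξ.const_smul M⁻¹)
      (le_iSup_of_le ?_ (le_iSup_of_le ?_ le_rfl)))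
    · exact hc.smul_left (f := fun _ => M⁻¹)
    · intro x
      rw [norm_smul, Real.norm_of_nonneg (by positivity), inv_mul_le_iff₀ hM]
      simpa using hξM x
  rw [ENNReal.ofReal_le_iff_le_toReal hA] at h1
  simp only [divergence_const_smul hd, integral_const_mul] at h1
  rw [← mul_neg, inv_mul_le_iff₀ hM] at h1
  exact h1

theorem abs_setIntegral_divergence_le {A : Set (EuclideanSpace ℝ (Fin d))}
    (hA : perimeter A ≠ ∞) {ξ : EuclideanSpace ℝ (Fin d) → EuclideanSpace ℝ (Fin d)}
    (hξ : ContDiff ℝ 1 ξ) (hc : HasCompactSupport ξ) {M : ℝ} (hM : 0 < M)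
    (hξM : ∀ x, ‖ξ x‖ ≤ M) :
    |∫ x in A, divergence ξ x| ≤ M * (perimeter A).toReal := by
  have hd : Differentiable ℝ ξ := hξ.differentiable one_ne_zero
  have h1 := neg_setIntegral_divergence_le hA hξ hc hM hξM
  have h2 := neg_setIntegral_divergence_le hA (ξ := fun z => (-1 : ℝ) • ξ z)
    (hξ.const_smul (-1 : ℝ)) (hc.smul_left (f := fun _ => (-1 : ℝ))) hM (by simpa using hξM)
  simp only [divergence_const_smul hd, integral_const_mul] at h2
  rw [abs_le]
  constructor <;> linarith

theorem divergence_smul_const {g : EuclideanSpace ℝ (Fin d) → ℝ} (hg : Differentiable ℝ g)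
    (y x : EuclideanSpace ℝ (Fin d)) :
    divergence (fun z => g z • y) x = fderiv ℝ g x y := by
  have hy : y = ∑ i, y i • EuclideanSpace.single i (1 : ℝ) := by
    ext j
    simp [Finset.sum_apply, Pi.single_apply]
  conv_rhs => rw [hy]
  rw [map_sum]
  simp only [divergence]
  refine Finset.sum_congr rfl fun i _ => ?_
  rw [fderiv_smul_const (hg x)]
  simp [mul_comm]

/-- Translating a test function changes its integral over `A` by at most the length of the
translation times the perimeter. -/
theorem abs_setIntegral_sub_translate_le {A : Set (EuclideanSpace ℝ (Fin d))}
    (hA : perimeter A ≠ ∞) (hvol : volume A ≠ ∞) {g : EuclideanSpace ℝ (Fin d) → ℝ}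
    (hg : ContDiff ℝ 1 g) (hc : HasCompactSupport g) (hg1 : ∀ x, |g x| ≤ 1)
    (y : EuclideanSpace ℝ (Fin d)) :
    |(∫ x in A, g x) - ∫ x in A, g (x - y)| ≤ ‖y‖ * (perimeter A).toReal := by
  rcases eq_or_ne y 0 with rfl | hy
  · simp
  have hfin : IsFiniteMeasure (volume.restrict A) := ⟨by simpa using hvol.lt_top⟩
  have hd : Differentiable ℝ g := hg.differentiable one_ne_zero
  have hfc : Continuous (fderiv ℝ g) := hg.continuous_fderiv one_ne_zero
  obtain ⟨B, hB⟩ := (hc.fderiv ℝ).exists_bound_of_continuous hfc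
  have hder : ∀ s : ℝ, HasDerivAt (fun s : ℝ => ∫ x in A, g (x - s • y))
      (∫ x in A, -(fderiv ℝ g (x - s • y) y)) s := by
    intro s
    refine (hasDerivAt_integral_of_dominated_loc_of_deriv_le (s := Set.univ) univ_mem
      (bound := fun _ => B * ‖y‖) (F' := fun s x => -(fderiv ℝ g (x - s • y) y))
      ?_ ?_ ?_ ?_ (integrable_const _) ?_).2
    · exact Eventually.of_forall fun s =>
        (hg.continuous.comp (by fun_prop)).aestronglyMeasurable
    · refine Integrable.of_bound (hg.continuous.comp (by fun_prop)).aestronglyMeasurable 1 ?_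
      exact Eventually.of_forall fun x => hg1 _
    · refine Continuous.aestronglyMeasurable ?_
      exact ((hfc.comp (by fun_prop)).clm_apply continuous_const).neg
    · refine Eventually.of_forall fun x s _ => ?_
      rw [norm_neg]
      exact (ContinuousLinearMap.le_opNorm _ _).trans
        (mul_le_mul_of_nonneg_right (hB _) (norm_nonneg _))
    · refine Eventually.of_forall fun x s _ => ?_
      have h1 : HasDerivAt (fun s : ℝ => x - s • y) (-y) s := by
        simpa using ((hasDerivAt_id s).smul_const y).const_sub x
      have := (hd (x - s • y)).hasFDerivAt.comp_hasDerivAt s h1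
      simpa [Function.comp_def] using this
  -- The field `z ↦ g (z - s • y) • y` has norm at most `‖y‖`, and its divergence is the derivative
  -- of the translated `g` in direction `y`; the flux bound therefore applies.
  have hbound : ∀ s : ℝ, ‖∫ x in A, -(fderiv ℝ g (x - s • y) y)‖ ≤ ‖y‖ * (perimeter A).toReal := by
    intro s
    have hg' : ContDiff ℝ 1 fun z => g (z - s • y) := hg.comp (contDiff_id.sub contDiff_const)
    have hc' : HasCompactSupport fun z => g (z - s • y) := by
      simpa [Function.comp_def] using hc.comp_homeomorph (Homeomorph.subRight (s • y))
    have h := abs_setIntegral_divergence_le hA (ξ := fun z => g (z - s • y) • y)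
      (hg'.smul contDiff_const) (hc'.smul_right (f' := fun _ => y)) (norm_pos_iff.2 hy)
      (fun x => by
        rw [norm_smul]
        exact mul_le_of_le_one_left (norm_nonneg _) (hg1 _))
    simp only [divergence_smul_const (hg'.differentiable one_ne_zero), fderiv_comp_sub] at h
    rwa [integral_neg, norm_neg, Real.norm_eq_abs]
  have h01 := Convex.norm_image_sub_le_of_norm_hasDerivWithin_le (s := Set.univ)
    (f := fun s : ℝ => ∫ x in A, g (x - s • y)) (fun s _ => (hder s).hasDerivWithinAt)
    (fun s _ => hbound s) convex_univ (Set.mem_univ 1) (Set.mem_univ 0)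
  simpa using h01

end Perimeter

/-! ### The `L^1` distance of sets by duality with smooth functions -/

section Duality

/-- Since `g ≥ -1` on `A \ K`, the integral is at least the measure of `K` minus that of `A \ K`. -/
theorem two_mul_measureReal_sub_le_setIntegral {V : Type*} [MeasurableSpace V] {μ : Measure V}
    {A K : Set V} (hK : MeasurableSet K) (hKA : K ⊆ A) (hA : μ A ≠ ∞) {g : V → ℝ}
    (hg : AEStronglyMeasurable g μ) (hg1 : ∀ x, |g x| ≤ 1) (hgK : ∀ x ∈ K, g x = 1) :
    2 * μ.real K - μ.real A ≤ ∫ x in A, g x ∂μ := by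
  have hfin : IsFiniteMeasure (μ.restrict A) := ⟨by simpa using hA.lt_top⟩
  have hint : IntegrableOn g A μ :=
    Integrable.of_bound hg.restrict 1 (Eventually.of_forall hg1)
  have hKfin : μ K ≠ ∞ := measure_ne_top_of_subset hKA hA
  have h1 : ∫ x in K, g x ∂μ = μ.real K := by
    rw [setIntegral_congr_fun hK (fun x hx => hgK x hx)]
    simp
  have h2 : -μ.real (A \ K) ≤ ∫ x in A \ K, g x ∂μ := by
    have := norm_setIntegral_le_of_norm_le_const (μ := μ) (s := A \ K) (f := g) (C := 1)
      ((measure_mono Set.sdiff_subset).trans_lt hA.lt_top) (fun x _ => hg1 x)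
    rw [Real.norm_eq_abs, abs_le] at this
    linarith [this.1]
  have h3 := integral_inter_add_sdiff hK hint
  rw [Set.inter_eq_self_of_subset_right hKA, h1] at h3
  have h4 : μ.real (A \ K) = μ.real A - μ.real K := measureReal_sdiff hKA hK hA
  linarith

variable {d : ℕ}

/-- A smooth function equal to `1` on `K`, vanishing on a disjoint compact set and outside a
bounded set. -/
theorem exists_contDiff_one_zero {K K' : Set (EuclideanSpace ℝ (Fin d))} (hK : IsCompact K)
    (hK' : IsCompact K') (hd : Disjoint K K') :
    ∃ g : EuclideanSpace ℝ (Fin d) → ℝ, ContDiff ℝ 1 g ∧ HasCompactSupport g ∧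
      (∀ x, 0 ≤ g x ∧ g x ≤ 1) ∧ (∀ x ∈ K, g x = 1) ∧ (∀ x ∈ K', g x = 0) := by
  obtain ⟨R, hR⟩ := hK.isBounded.subset_ball 0
  obtain ⟨g, hg, hr, h0, h1⟩ := exists_contMDiff_zero_iff_one_iff_of_isClosed
    (modelWithCornersSelf ℝ (EuclideanSpace ℝ (Fin d))) (n := 1)
    (s := K' ∪ (Metric.ball 0 R)ᶜ) (t := K)
    (hK'.isClosed.union Metric.isOpen_ball.isClosed_compl) hK.isClosed
    (by
      rw [Set.disjoint_union_left]
      exact ⟨hd.symm, Set.disjoint_left.2 fun x hx hxK => hx (hR hxK)⟩)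
  refine ⟨g, contMDiff_iff_contDiff.1 hg, ?_, fun x => hr ⟨x, rfl⟩, fun x hx => (h1 x).1 hx,
    fun x hx => (h0 x).1 (Or.inl hx)⟩
  refine HasCompactSupport.intro (isCompact_closedBall 0 R) fun x hx => (h0 x).1 (Or.inr ?_)
  exact fun hx' => hx (Metric.ball_subset_closedBall hx')

/-- The optimal test function would be `1` on `E \ F` and `-1` on `F \ E`. Inner regularity replaces
these two sets by disjoint compact sets, between which a smooth function can interpolate. A loss of
`ε / 4` in each measure counts twice, which gives `ε` in total. -/
theorem measureReal_diff_add_le_of_forall_test {E F : Set (EuclideanSpace ℝ (Fin d))}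
    (hE : MeasurableSet E) (hF : MeasurableSet F) (hE' : volume E ≠ ∞) (hF' : volume F ≠ ∞) {B : ℝ}
    (h : ∀ g : EuclideanSpace ℝ (Fin d) → ℝ, ContDiff ℝ 1 g → HasCompactSupport g →
      (∀ x, |g x| ≤ 1) → (∫ x in E, g x) - ∫ x in F, g x ≤ B) :
    volume.real (E \ F) + volume.real (F \ E) ≤ B := by
  refine le_of_forall_pos_le_add fun ε hε => ?_
  have key : ∀ A : Set (EuclideanSpace ℝ (Fin d)), MeasurableSet A → volume A ≠ ∞ →
      ∃ K ⊆ A, IsCompact K ∧ volume.real A < volume.real K + ε / 4 := by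
    intro A hA hA'
    obtain ⟨K, hKA, hK, hlt⟩ := hA.exists_isCompact_lt_add hA'
      (ENNReal.ofReal_pos.2 (by positivity : 0 < ε / 4)).ne'
    refine ⟨K, hKA, hK, ?_⟩
    have := (ENNReal.toReal_lt_toReal hA' (by finiteness [hK.measure_ne_top (μ := volume)])).2 hlt
    rwa [ENNReal.toReal_add hK.measure_ne_top (by finiteness),
      ENNReal.toReal_ofReal (by positivity)] at this
  have hEF : volume (E \ F) ≠ ∞ := measure_ne_top_of_subset Set.sdiff_subset hE'
  have hFE : volume (F \ E) ≠ ∞ := measure_ne_top_of_subset Set.sdiff_subset hF'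
  obtain ⟨K₁, hK₁E, hK₁, hlt₁⟩ := key _ (hE.diff hF) hEF
  obtain ⟨K₂, hK₂F, hK₂, hlt₂⟩ := key _ (hF.diff hE) hFE
  have hdisj : Disjoint K₁ K₂ :=
    Set.disjoint_left.2 fun x hx hx' => (hK₂F hx').2 (hK₁E hx).1
  obtain ⟨g₁, hg₁, hc₁, hr₁, h11, h10⟩ := exists_contDiff_one_zero hK₁ hK₂ hdisj
  obtain ⟨g₂, hg₂, hc₂, hr₂, h21, h20⟩ := exists_contDiff_one_zero hK₂ hK₁ hdisj.symm
  set g := fun x => g₁ x - g₂ x with hgdef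
  have hg : ContDiff ℝ 1 g := hg₁.sub hg₂
  have hgc : HasCompactSupport g := hc₁.sub hc₂
  have hb : ∀ x, |g x| ≤ 1 := fun x => by
    rw [abs_le]
    constructor <;> simp only [hgdef] <;> linarith [(hr₁ x).1, (hr₁ x).2, (hr₂ x).1, (hr₂ x).2]
  have i₁ := two_mul_measureReal_sub_le_setIntegral (μ := volume) hK₁.measurableSet hK₁E hEF
    hg.continuous.aestronglyMeasurable hb (fun x hx => by simp [hgdef, h11 x hx, h20 x hx])
  have i₂ := two_mul_measureReal_sub_le_setIntegral (μ := volume) hK₂.measurableSet hK₂F hFE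
    (g := fun x => -g x) hg.continuous.neg.aestronglyMeasurable (by simpa using hb)
    (fun x hx => by simp [hgdef, h10 x hx, h21 x hx])
  rw [integral_neg] at i₂
  have hint : Integrable g volume := hg.continuous.integrable_of_hasCompactSupport hgc
  -- The contributions of `E ∩ F` cancel in the difference.
  have j₁ := integral_inter_add_sdiff hF (hint.integrableOn (s := E))
  have j₂ := integral_inter_add_sdiff hE (hint.integrableOn (s := F))
  rw [Set.inter_comm] at j₂
  linarith [h g hg hgc hb]

theorem measure_symmDiff_congr {V : Type*} [MeasurableSpace V] {μ : Measure V} {E E' F F' : Set V}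
    (hE : E =ᵐ[μ] E') (hF : F =ᵐ[μ] F') : μ (E ∆ F) = μ (E' ∆ F') :=
  measure_congr ((hE.diff hF).union (hF.diff hE))

/-- The `L^1` distance of two characteristic functions by duality with `C_c^1` functions. -/
theorem measure_symmDiff_le_of_forall_test {E F : Set (EuclideanSpace ℝ (Fin d))}
    (hE : NullMeasurableSet E) (hF : NullMeasurableSet F) (hE' : volume E ≠ ∞)
    (hF' : volume F ≠ ∞) {B : ℝ}
    (h : ∀ g : EuclideanSpace ℝ (Fin d) → ℝ, ContDiff ℝ 1 g → HasCompactSupport g →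
      (∀ x, |g x| ≤ 1) → (∫ x in E, g x) - ∫ x in F, g x ≤ B) :
    volume (E ∆ F) ≤ ENNReal.ofReal B := by
  obtain ⟨E₁, -, hE₁, hEE⟩ := hE.exists_measurable_superset_ae_eq
  obtain ⟨F₁, -, hF₁, hFF⟩ := hF.exists_measurable_superset_ae_eq
  have h1 := measureReal_diff_add_le_of_forall_test hE₁ hF₁ (by rwa [measure_congr hEE])
    (by rwa [measure_congr hFF]) (B := B) (fun g hg hc hb => by
      rw [setIntegral_congr_set hEE, setIntegral_congr_set hFF]
      exact h g hg hc hb)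
  rw [← measure_symmDiff_congr hEE hFF, Set.symmDiff_def]
  refine (measure_union_le _ _).trans ?_
  have h2 : volume (E₁ \ F₁) ≠ ∞ :=
    measure_ne_top_of_subset Set.sdiff_subset (by rwa [measure_congr hEE])
  have h3 : volume (F₁ \ E₁) ≠ ∞ :=
    measure_ne_top_of_subset Set.sdiff_subset (by rwa [measure_congr hFF])
  rw [← ENNReal.ofReal_toReal h2, ← ENNReal.ofReal_toReal h3,
    ← ENNReal.ofReal_add ENNReal.toReal_nonneg ENNReal.toReal_nonneg]
  exact ENNReal.ofReal_le_ofReal h1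

end Duality

/-! ### Trading perimeter for Lipschitz regularity of test functions -/

section Mollification

variable {d : ℕ}

/-- A normalized mollifier supported in the unit ball whose translates are Lipschitz in `L^1`. -/
structure IsMollifier (φ : EuclideanSpace ℝ (Fin d) → ℝ) (L : ℝ) : Prop where
  continuous : Continuous φ
  nonneg : ∀ y, 0 ≤ φ y
  integrable : Integrable φ
  integral_eq_one : ∫ y, φ y = 1
  eq_zero : ∀ y, 1 < ‖y‖ → φ y = 0
  pos : 0 < L
  translate : ∀ w, ∫ y, |φ y - φ (y + w)| ≤ L * ‖w‖

theorem exists_isMollifier (d : ℕ) :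
    ∃ (φ : EuclideanSpace ℝ (Fin d) → ℝ) (L : ℝ), IsMollifier φ L := by
  let f : ContDiffBump (0 : EuclideanSpace ℝ (Fin d)) := ⟨1 / 2, 1, by norm_num, by norm_num⟩
  have hcont : Continuous (f.normed volume) := f.continuous_normed
  have hsupp : ∀ y, 1 < ‖y‖ → f.normed volume y = 0 := by
    intro y hy
    have : y ∉ Function.support (f.normed volume) := by
      rw [f.support_normed_eq]
      simpa [f] using hy.le
    simpa using this
  obtain ⟨K, hK⟩ := ContDiff.lipschitzWith_of_hasCompactSupport (𝕂 := ℝ) (n := 1)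
    (f.hasCompactSupport_normed (μ := volume)) (f.contDiff_normed (n := 1)) one_ne_zero
  -- The first term of `L` handles `‖w‖ ≤ 1`, where the integrand lives in the ball of radius `2`
  -- and is at most `K ‖w‖`. The term `2` handles `‖w‖ > 1`, where the integral is at most `2`.
  refine ⟨f.normed volume, K * volume.real (Metric.closedBall (0 : EuclideanSpace ℝ (Fin d)) 2) + 2,
    hcont, f.nonneg_normed, f.integrable_normed, f.integral_normed, hsupp, by positivity, ?_⟩
  intro w
  have hi := f.integrable_normed (μ := volume)
  rcases le_or_gt ‖w‖ 1 with hw | hw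
  · have hzero : ∀ y, y ∉ Metric.closedBall (0 : EuclideanSpace ℝ (Fin d)) 2 →
        |f.normed volume y - f.normed volume (y + w)| = 0 := by
      intro y hy
      have hy' : 2 < ‖y‖ := by simpa using hy
      have : ‖y‖ ≤ ‖y + w‖ + ‖w‖ := by simpa using norm_sub_le (y + w) w
      rw [hsupp y (by linarith), hsupp (y + w) (by linarith)]
      simp
    rw [← setIntegral_eq_integral_of_forall_compl_eq_zero hzero]
    have hle := norm_setIntegral_le_of_norm_le_const (μ := volume)
      (s := Metric.closedBall (0 : EuclideanSpace ℝ (Fin d)) 2)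
      (f := fun y => |f.normed volume y - f.normed volume (y + w)|) (C := K * ‖w‖)
      (isCompact_closedBall _ _).measure_lt_top (fun y _ => by
        have := hK.dist_le_mul y (y + w)
        simpa [Real.dist_eq] using this)
    refine (le_abs_self _).trans (hle.trans ?_)
    nlinarith [norm_nonneg w]
  · have : ∫ y, |f.normed volume y - f.normed volume (y + w)| ≤
        ∫ y, (f.normed volume y + f.normed volume (y + w)) := by
      refine integral_mono ((hi.sub (hi.comp_add_right w)).abs) (hi.add (hi.comp_add_right w)) ?_
      intro y
      refine (abs_sub _ _).trans ?_
      rw [abs_of_nonneg (f.nonneg_normed y), abs_of_nonneg (f.nonneg_normed _)]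
    rw [integral_add hi (hi.comp_add_right w), integral_add_right_eq_self (f.normed volume) w,
      f.integral_normed] at this
    have hnn : 0 ≤ K * volume.real (Metric.closedBall (0 : EuclideanSpace ℝ (Fin d)) 2) * ‖w‖ := by
      positivity
    linarith

/-- The average `x ↦ ∫ φ(y) g(x - r y) dy`. -/
noncomputable def mollify (φ : EuclideanSpace ℝ (Fin d) → ℝ) (r : ℝ)
    (g : EuclideanSpace ℝ (Fin d) → ℝ) (x : EuclideanSpace ℝ (Fin d)) : ℝ :=
  ∫ y, φ y * g (x - r • y)

variable {φ : EuclideanSpace ℝ (Fin d) → ℝ} {L : ℝ}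

theorem IsMollifier.integrable_mul (hφ : IsMollifier φ L) {g : EuclideanSpace ℝ (Fin d) → ℝ}
    (hg : Continuous g) (hg1 : ∀ x, |g x| ≤ 1) (r : ℝ) (x : EuclideanSpace ℝ (Fin d)) :
    Integrable fun y => φ y * g (x - r • y) := by
  refine hφ.integrable.mul_bdd (c := 1) ?_ (Eventually.of_forall fun y => hg1 _)
  exact (hg.comp (by fun_prop)).aestronglyMeasurable

theorem IsMollifier.abs_mollify_le (hφ : IsMollifier φ L) {g : EuclideanSpace ℝ (Fin d) → ℝ}
    (hg1 : ∀ x, |g x| ≤ 1) (r : ℝ) (x : EuclideanSpace ℝ (Fin d)) : |mollify φ r g x| ≤ 1 := by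
  rw [mollify, ← hφ.integral_eq_one, ← Real.norm_eq_abs]
  refine norm_integral_le_of_norm_le hφ.integrable (Eventually.of_forall fun y => ?_)
  rw [Real.norm_eq_abs, abs_mul, abs_of_nonneg (hφ.nonneg y)]
  exact mul_le_of_le_one_right (hφ.nonneg y) (hg1 _)

/-- A change of variables moves the shift from `g` onto `φ`, so the bound does not see the
derivative of `g`. In the rescaled variable the shift is `(x' - x) / r`, whence the constant `L /
r`. -/
theorem IsMollifier.abs_mollify_sub_le (hφ : IsMollifier φ L) {g : EuclideanSpace ℝ (Fin d) → ℝ}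
    (hg : Continuous g) (hg1 : ∀ x, |g x| ≤ 1) {r : ℝ} (hr : 0 < r)
    (x x' : EuclideanSpace ℝ (Fin d)) :
    |mollify φ r g x - mollify φ r g x'| ≤ L / r * ‖x - x'‖ := by
  set w := r⁻¹ • (x' - x) with hw
  have hshift : ∀ y, x' - r • (y + w) = x - r • y := by
    intro y
    rw [hw, smul_add, smul_smul, mul_inv_cancel₀ hr.ne', one_smul]
    abel
  have h1 : mollify φ r g x' = ∫ y, φ (y + w) * g (x - r • y) := by
    rw [mollify, ← integral_add_right_eq_self _ w]
    simp only [hshift]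
  have hi' : Integrable fun y => φ (y + w) * g (x - r • y) := by
    simpa only [hshift] using (hφ.integrable_mul hg hg1 r x').comp_add_right w
  rw [h1, mollify, ← integral_sub (hφ.integrable_mul hg hg1 r x) hi']
  have hle : ‖∫ y, (φ y * g (x - r • y) - φ (y + w) * g (x - r • y))‖ ≤
      ∫ y, |φ y - φ (y + w)| := by
    refine norm_integral_le_of_norm_le
      (hφ.integrable.sub (hφ.integrable.comp_add_right w)).abs (Eventually.of_forall fun y => ?_)
    rw [← sub_mul, Real.norm_eq_abs, abs_mul]
    exact mul_le_of_le_one_right (abs_nonneg _) (hg1 _)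
  refine (hle.trans (hφ.translate w)).trans (le_of_eq ?_)
  rw [hw, norm_smul, Real.norm_of_nonneg (by positivity), norm_sub_rev]
  ring

/-- Mollification at scale `r` changes the integral over `A` by at most `r P(A)`. -/
theorem IsMollifier.abs_setIntegral_sub_mollify_le (hφ : IsMollifier φ L)
    {A : Set (EuclideanSpace ℝ (Fin d))} (hA : perimeter A ≠ ∞) (hvol : volume A ≠ ∞)
    {g : EuclideanSpace ℝ (Fin d) → ℝ} (hg : ContDiff ℝ 1 g) (hc : HasCompactSupport g)
    (hg1 : ∀ x, |g x| ≤ 1) {r : ℝ} (hr : 0 < r) :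
    |(∫ x in A, g x) - ∫ x in A, mollify φ r g x| ≤ r * (perimeter A).toReal := by
  have hfin : IsFiniteMeasure (volume.restrict A) := ⟨by simpa using hvol.lt_top⟩
  have hprod : Integrable (Function.uncurry fun (x y : EuclideanSpace ℝ (Fin d)) =>
      φ y * g (x - r • y)) ((volume.restrict A).prod volume) := by
    have h1 : Integrable (fun p : EuclideanSpace ℝ (Fin d) × EuclideanSpace ℝ (Fin d) => φ p.2)
        ((volume.restrict A).prod volume) := hφ.integrable.comp_snd _
    refine h1.mul_bdd (c := 1) ?_ (Eventually.of_forall fun p => hg1 _)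
    exact (hg.continuous.comp (by fun_prop)).aestronglyMeasurable
  have hswap : ∫ x in A, mollify φ r g x = ∫ y, φ y * ∫ x in A, g (x - r • y) := by
    simp only [mollify]
    rw [integral_integral_swap hprod]
    simp only [integral_const_mul]
  have hswapi : Integrable fun y => φ y * ∫ x in A, g (x - r • y) := by
    have := hprod.integral_prod_right
    simpa only [Function.uncurry, integral_const_mul] using this
  have hconst : ∫ x in A, g x = ∫ y, φ y * ∫ x in A, g x := by
    rw [integral_mul_const, hφ.integral_eq_one, one_mul]
  rw [hswap, hconst, ← integral_sub (hφ.integrable.mul_const _) hswapi]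
  have : r * (perimeter A).toReal = ∫ y, φ y * (r * (perimeter A).toReal) := by
    rw [integral_mul_const, hφ.integral_eq_one, one_mul]
  rw [this, ← Real.norm_eq_abs]
  refine norm_integral_le_of_norm_le (hφ.integrable.mul_const _) (Eventually.of_forall fun y => ?_)
  rw [← mul_sub, Real.norm_eq_abs, abs_mul, abs_of_nonneg (hφ.nonneg y)]
  rcases le_or_gt ‖y‖ 1 with hy | hy
  · refine mul_le_mul_of_nonneg_left ?_ (hφ.nonneg y)
    refine (abs_setIntegral_sub_translate_le hA hvol hg hc hg1 (r • y)).trans ?_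
    refine mul_le_mul_of_nonneg_right ?_ ENNReal.toReal_nonneg
    rw [norm_smul, Real.norm_of_nonneg hr.le]
    exact mul_le_of_le_one_right hr.le hy
  · simp [hφ.eq_zero y hy]

/-- For sets of perimeter at most `P`, the `L^1` distance is controlled by duality with bounded
Lipschitz functions, at the cost of a term `2 r P`. -/
theorem IsMollifier.measure_symmDiff_le (hφ : IsMollifier φ L)
    {E F : Set (EuclideanSpace ℝ (Fin d))} (hE : NullMeasurableSet E) (hF : NullMeasurableSet F)
    (hE' : volume E ≠ ∞) (hF' : volume F ≠ ∞) {P : ℝ≥0∞} (hP : P ≠ ∞) (hPE : perimeter E ≤ P)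
    (hPF : perimeter F ≤ P) {r B : ℝ} (hr : 0 < r)
    (h : ∀ G : EuclideanSpace ℝ (Fin d) → ℝ, (∀ x, |G x| ≤ 1) →
      (∀ x x', |G x - G x'| ≤ L / r * ‖x - x'‖) → (∫ x in E, G x) - ∫ x in F, G x ≤ B) :
    volume (E ∆ F) ≤ ENNReal.ofReal (2 * r * P.toReal + B) := by
  refine measure_symmDiff_le_of_forall_test hE hF hE' hF' fun g hg hc hg1 => ?_
  have h1 := hφ.abs_setIntegral_sub_mollify_le (ne_top_of_le_ne_top hP hPE) hE' hg hc hg1 hr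
  have h2 := hφ.abs_setIntegral_sub_mollify_le (ne_top_of_le_ne_top hP hPF) hF' hg hc hg1 hr
  have h3 := h _ (hφ.abs_mollify_le hg1 r) (hφ.abs_mollify_sub_le hg.continuous hg1 hr)
  have h4 : r * (perimeter E).toReal ≤ r * P.toReal :=
    mul_le_mul_of_nonneg_left (ENNReal.toReal_mono hP hPE) hr.le
  have h5 : r * (perimeter F).toReal ≤ r * P.toReal :=
    mul_le_mul_of_nonneg_left (ENNReal.toReal_mono hP hPF) hr.le
  rw [abs_le] at h1 h2
  linarith [h1.2, h2.1]

end Mollification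

/-! ### The Wasserstein distance and its interpolation with the perimeter -/

section Transport

variable {d : ℕ} {E F G : Set (EuclideanSpace ℝ (Fin d))}
  {γ : Measure (EuclideanSpace ℝ (Fin d) × EuclideanSpace ℝ (Fin d))}

theorem IsTransportPlan.measure_univ_left (hγ : IsTransportPlan E F γ) :
    γ Set.univ = volume E := by
  have := congrArg (fun μ => μ Set.univ) hγ.2.1
  simpa [Measure.map_apply measurable_fst MeasurableSet.univ] using this

theorem IsTransportPlan.measure_univ_right (hγ : IsTransportPlan E F γ) :
    γ Set.univ = volume F := by
  have := congrArg (fun μ => μ Set.univ) hγ.2.2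
  simpa [Measure.map_apply measurable_snd MeasurableSet.univ] using this

theorem IsTransportPlan.W2sq_le (hγ : IsTransportPlan E F γ) :
    W2sq E F ≤ ∫⁻ p, ‖p.1 - p.2‖ₑ ^ 2 ∂γ :=
  iInf₂_le γ hγ

theorem exists_isTransportPlan_of_W2sq_lt {a : ℝ≥0∞} (h : W2sq E F < a) :
    ∃ γ, IsTransportPlan E F γ ∧ ∫⁻ p, ‖p.1 - p.2‖ₑ ^ 2 ∂γ < a := by
  simpa [W2sq, iInf_lt_iff] using h

theorem volume_eq_of_W2sq_ne_top (h : W2sq E F ≠ ∞) : volume E = volume F := by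
  obtain ⟨γ, hγ, -⟩ := exists_isTransportPlan_of_W2sq_lt h.lt_top
  rw [← hγ.measure_univ_left, hγ.measure_univ_right]

theorem W2sq_eq_iInf : W2sq E F =
    ⨅ γ : {γ : Measure (EuclideanSpace ℝ (Fin d) × EuclideanSpace ℝ (Fin d)) //
      IsTransportPlan E F γ}, ∫⁻ p, ‖p.1 - p.2‖ₑ ^ 2 ∂γ.1 :=
  iInf_subtype'

/-- The square root is an order isomorphism of `[0, ∞]` and so passes inside the infimum. Estimates
can then be checked plan by plan, without an optimal plan. -/
theorem W2_eq_iInf : W2 E F =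
    ⨅ γ : {γ : Measure (EuclideanSpace ℝ (Fin d) × EuclideanSpace ℝ (Fin d)) //
      IsTransportPlan E F γ}, (∫⁻ p, ‖p.1 - p.2‖ₑ ^ 2 ∂γ.1) ^ (1 / 2 : ℝ) := by
  change ENNReal.orderIsoRpow (1 / 2) (by norm_num) (W2sq E F) = _
  rw [W2sq_eq_iInf, OrderIso.map_iInf]
  rfl

theorem W2_rpow_two : W2 E F ^ (2 : ℝ) = W2sq E F := by
  rw [W2, ← ENNReal.rpow_mul]
  norm_num

theorem W2sq_self (hE : volume E ≠ ∞) : W2sq E E = 0 := by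
  have hfin : IsFiniteMeasure (volume.restrict E) := ⟨by simpa using hE.lt_top⟩
  have hm : Measurable fun x : EuclideanSpace ℝ (Fin d) => (x, x) := by fun_prop
  have hγ : IsTransportPlan E E ((volume.restrict E).map fun x => (x, x)) := by
    refine ⟨inferInstance, ?_, ?_⟩
    · rw [Measure.map_map measurable_fst hm]
      exact Measure.map_id
    · rw [Measure.map_map measurable_snd hm]
      exact Measure.map_id
  refine le_antisymm (hγ.W2sq_le.trans ?_) bot_le
  rw [lintegral_map (by fun_prop) hm]
  simp

/-- Gluing of transport plans along the common marginal. -/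
theorem IsTransportPlan.exists_glue
    {γ₁ γ₂ : Measure (EuclideanSpace ℝ (Fin d) × EuclideanSpace ℝ (Fin d))}
    (h₁ : IsTransportPlan E F γ₁) (h₂ : IsTransportPlan F G γ₂) :
    ∃ η : Measure ((EuclideanSpace ℝ (Fin d) × EuclideanSpace ℝ (Fin d)) ×
        EuclideanSpace ℝ (Fin d)), IsFiniteMeasure η ∧
      η.map Prod.fst = γ₁ ∧ η.map (fun p => (p.1.2, p.2)) = γ₂ := by
  have := h₁.1
  have := h₂.1
  -- Given a point of `γ₁`, the third coordinate follows the conditional law of `γ₂` at the middle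
  -- coordinate.
  let κ : ProbabilityTheory.Kernel (EuclideanSpace ℝ (Fin d) × EuclideanSpace ℝ (Fin d))
      (EuclideanSpace ℝ (Fin d)) := γ₂.condKernel.comap Prod.snd measurable_snd
  refine ⟨γ₁.compProd κ, inferInstance, ?_, ?_⟩
  · exact Measure.fst_compProd _ _
  · refine Measure.ext_of_lintegral _ fun f hf => ?_
    rw [lintegral_map hf (by fun_prop), Measure.lintegral_compProd (by fun_prop)]
    conv_rhs => rw [← γ₂.disintegrate γ₂.condKernel]
    have hmar : γ₂.fst = γ₁.map Prod.snd := by rw [h₁.2.2]; exact h₂.2.1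
    rw [hmar, Measure.lintegral_compProd hf, lintegral_map ?_ measurable_snd]
    · rfl
    · exact hf.lintegral_kernel_prod_right'

/-- Minkowski's inequality in `L²(η)` for a gluing `η` of two arbitrary plans. -/
theorem W2_triangle (E F G : Set (EuclideanSpace ℝ (Fin d))) : W2 E G ≤ W2 E F + W2 F G := by
  simp only [W2_eq_iInf, ENNReal.iInf_add, ENNReal.add_iInf]
  refine le_iInf fun ⟨γ₂, h₂⟩ => le_iInf fun ⟨γ₁, h₁⟩ => ?_
  obtain ⟨η, hη, hη₁, hη₂⟩ := h₁.exists_glue h₂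
  have hm : Measurable fun p : (EuclideanSpace ℝ (Fin d) × EuclideanSpace ℝ (Fin d)) ×
      EuclideanSpace ℝ (Fin d) => (p.1.1, p.2) := by fun_prop
  have hm₂ : Measurable fun p : (EuclideanSpace ℝ (Fin d) × EuclideanSpace ℝ (Fin d)) ×
      EuclideanSpace ℝ (Fin d) => (p.1.2, p.2) := by fun_prop
  have hγ : IsTransportPlan E G (η.map fun p => (p.1.1, p.2)) := by
    refine ⟨inferInstance, ?_, ?_⟩
    · rw [Measure.map_map measurable_fst hm, ← h₁.2.1, ← hη₁,
        Measure.map_map measurable_fst measurable_fst]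
      rfl
    · rw [Measure.map_map measurable_snd hm, ← h₂.2.2, ← hη₂,
        Measure.map_map measurable_snd hm₂]
      rfl
  refine (iInf_le _ ⟨_, hγ⟩).trans ?_
  dsimp only
  rw [lintegral_map (by fun_prop) hm, ← hη₁, ← hη₂, lintegral_map (by fun_prop) measurable_fst,
    lintegral_map (by fun_prop) hm₂]
  have hmink := ENNReal.lintegral_Lp_add_le (μ := η) (p := 2)
    (f := fun p => ‖p.1.1 - p.1.2‖ₑ) (g := fun p => ‖p.1.2 - p.2‖ₑ)
    (by fun_prop) (by fun_prop) (by norm_num)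
  simp only [ENNReal.rpow_two, Pi.add_apply] at hmink
  refine le_trans (ENNReal.rpow_le_rpow (lintegral_mono fun p => ?_) (by norm_num)) hmink
  refine pow_le_pow_left' ?_ 2
  rw [← sub_add_sub_cancel p.1.1 p.1.2 p.2]
  exact enorm_add_le _ _

/-- The second moment of `E` is controlled by the one of `F` and the Wasserstein distance. -/
theorem lintegral_enorm_sq_le (E F : Set (EuclideanSpace ℝ (Fin d))) :
    ∫⁻ x in E, ‖x‖ₑ ^ 2 ≤ 2 * (∫⁻ x in F, ‖x‖ₑ ^ 2) + 2 * W2sq E F := by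
  rw [W2sq_eq_iInf, ENNReal.mul_iInf_of_ne two_ne_zero ENNReal.ofNat_ne_top, ENNReal.add_iInf]
  refine le_iInf fun ⟨γ, hγ⟩ => ?_
  rw [← hγ.2.1, ← hγ.2.2, lintegral_map (by fun_prop) measurable_fst,
    lintegral_map (by fun_prop) measurable_snd, ← lintegral_const_mul _ (by fun_prop),
    ← lintegral_const_mul _ (by fun_prop), ← lintegral_add_left (by fun_prop)]
  refine lintegral_mono fun p => ?_
  have h1 : ‖p.1‖ₑ ≤ ‖p.2‖ₑ + ‖p.1 - p.2‖ₑ := by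
    have := enorm_add_le p.2 (p.1 - p.2)
    rwa [add_sub_cancel] at this
  refine (pow_le_pow_left' h1 2).trans ?_
  have := ENNReal.rpow_add_le_mul_rpow_add_rpow ‖p.2‖ₑ ‖p.1 - p.2‖ₑ (p := 2) (by norm_num)
  norm_num at this
  rwa [mul_add] at this

/-- Functions with Lipschitz constant `K` are controlled by duality by `K |E|^{1/2} W_2(E, F)`. -/
theorem ofReal_setIntegral_sub_le (hE : volume E ≠ ∞) (hW : W2 E F ≠ ∞)
    {g : EuclideanSpace ℝ (Fin d) → ℝ} {K : ℝ}
    (hK : 0 ≤ K) (hg1 : ∀ x, |g x| ≤ 1) (hg : ∀ x x', |g x - g x'| ≤ K * ‖x - x'‖) :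
    ENNReal.ofReal ((∫ x in E, g x) - ∫ x in F, g x) ≤
      ENNReal.ofReal K * volume E ^ (1 / 2 : ℝ) * W2 E F := by
  have hcont : Continuous g := by
    refine (LipschitzWith.of_dist_le_mul (K := ⟨K, hK⟩) fun x y => ?_).continuous
    rw [Real.dist_eq, dist_eq_norm]
    exact hg x y
  -- The prefactor may vanish, and `0` can be moved inside an infimum only over a nonempty family.
  have hne : Nonempty {γ : Measure (EuclideanSpace ℝ (Fin d) × EuclideanSpace ℝ (Fin d)) //
      IsTransportPlan E F γ} := by
    by_contra hemp
    rw [not_nonempty_iff] at hemp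
    exact hW (by rw [W2_eq_iInf, iInf_of_empty])
  rw [W2_eq_iInf, ENNReal.mul_iInf' (fun h => absurd h (by finiteness)) (fun _ => hne)]
  refine le_iInf fun ⟨γ, hγ⟩ => ?_
  have := hγ.1
  have hi : ∀ f : EuclideanSpace ℝ (Fin d) × EuclideanSpace ℝ (Fin d) →
      EuclideanSpace ℝ (Fin d), Continuous f → Integrable (fun p => g (f p)) γ := fun f hf =>
    Integrable.of_bound (hcont.comp hf).aestronglyMeasurable 1 (Eventually.of_forall fun p => hg1 _)
  rw [← hγ.measure_univ_left, ← hγ.2.1, ← hγ.2.2,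
    integral_map measurable_fst.aemeasurable hcont.aestronglyMeasurable,
    integral_map measurable_snd.aemeasurable hcont.aestronglyMeasurable,
    ← integral_sub (hi _ continuous_fst) (hi _ continuous_snd)]
  calc ENNReal.ofReal (∫ p, (g p.1 - g p.2) ∂γ)
      ≤ ‖∫ p, (g p.1 - g p.2) ∂γ‖ₑ := by
        rw [← ofReal_norm]
        exact ENNReal.ofReal_le_ofReal (le_abs_self _)
    _ ≤ ∫⁻ p, ‖g p.1 - g p.2‖ₑ ∂γ := enorm_integral_le_lintegral_enorm _
    _ ≤ ∫⁻ p, ENNReal.ofReal K * (1 * ‖p.1 - p.2‖ₑ) ∂γ := by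
        refine lintegral_mono fun p => ?_
        rw [one_mul, ← ofReal_norm, ← ofReal_norm, ← ENNReal.ofReal_mul hK]
        exact ENNReal.ofReal_le_ofReal (hg _ _)
    _ = ENNReal.ofReal K * ∫⁻ p, 1 * ‖p.1 - p.2‖ₑ ∂γ := lintegral_const_mul _ (by fun_prop)
    _ ≤ ENNReal.ofReal K * (γ Set.univ ^ (1 / 2 : ℝ) *
          (∫⁻ p, ‖p.1 - p.2‖ₑ ^ 2 ∂γ) ^ (1 / 2 : ℝ)) := by
        gcongr
        have := ENNReal.lintegral_mul_le_Lp_mul_Lq γ Real.HolderConjugate.two_two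
          (f := fun _ => 1) (g := fun p => ‖p.1 - p.2‖ₑ) (by fun_prop) (by fun_prop)
        simpa using this
    _ = _ := by rw [mul_assoc]

/-- Interpolation between the perimeter and the Wasserstein distance. -/
theorem exists_measure_symmDiff_sq_le (d : ℕ) : ∃ C : ℝ, 0 < C ∧
    ∀ (E F : Set (EuclideanSpace ℝ (Fin d))), NullMeasurableSet E → NullMeasurableSet F →
      volume E ≠ ∞ → W2 E F ≠ ∞ → ∀ P : ℝ≥0∞, P ≠ ∞ → perimeter E ≤ P → perimeter F ≤ P →
      volume (E ∆ F) ^ 2 ≤ ENNReal.ofReal C * P * volume E ^ (1 / 2 : ℝ) * W2 E F := by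
  obtain ⟨φ, L, hφ⟩ := exists_isMollifier d
  have hL := hφ.pos
  refine ⟨8 * L, by positivity, fun E F hE hF hvE hW P hP hPE hPF => ?_⟩
  have hvF : volume F ≠ ∞ := by
    rwa [← volume_eq_of_W2sq_ne_top (E := E) (F := F)]
    rw [← W2_rpow_two]
    finiteness
  have hfin : volume (E ∆ F) ≠ ∞ :=
    ne_top_of_le_ne_top (ENNReal.add_ne_top.2 ⟨hvE, hvF⟩)
      ((measure_mono Set.symmDiff_subset_union).trans (measure_union_le _ _))
  set X := (volume (E ∆ F)).toReal
  set D := volume E ^ (1 / 2 : ℝ) * W2 E F with hD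
  have hDfin : D ≠ ∞ := by finiteness
  have hX : ∀ r : ℝ, 0 < r → X ≤ 2 * r * P.toReal + L / r * D.toReal := by
    intro r hr
    refine ENNReal.toReal_le_of_le_ofReal (by positivity)
      (hφ.measure_symmDiff_le hE hF hvE hvF hP hPE hPF hr fun G hG1 hG => ?_)
    have h := ofReal_setIntegral_sub_le hvE hW (K := L / r) (by positivity) hG1 hG
    rw [mul_assoc, ← hD, ← ENNReal.ofReal_toReal hDfin, ← ENNReal.ofReal_mul (by positivity)] at h
    exact (ENNReal.ofReal_le_ofReal_iff (by positivity)).1 h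
  -- Optimization in `r`: after multiplication by `r`, the bound says that `2 P r² - X r + L D` is
  -- nonnegative for all `r`. Its discriminant `X² - 8 L P D` is then nonpositive, hence the
  -- constant `8 * L`.
  have hdisc : discrim (2 * P.toReal) (-X) (L * D.toReal) ≤ 0 := by
    refine discrim_le_zero fun r => ?_
    rcases le_or_gt r 0 with hr | hr
    · have : 0 ≤ X * -r := mul_nonneg ENNReal.toReal_nonneg (by linarith)
      have h2 : 0 ≤ 2 * P.toReal * (r * r) := mul_nonneg (by positivity) (mul_self_nonneg r)
      have h3 : 0 ≤ L * D.toReal := by positivity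
      linarith
    · have := mul_le_mul_of_nonneg_right (hX r hr) hr.le
      rw [add_mul, div_mul_eq_mul_div, div_mul_cancel₀ _ hr.ne'] at this
      linarith
  rw [discrim] at hdisc
  rw [mul_assoc, ← hD, ← ENNReal.ofReal_toReal hfin, ← ENNReal.ofReal_toReal hP,
    ← ENNReal.ofReal_toReal hDfin, ← ENNReal.ofReal_pow ENNReal.toReal_nonneg,
    ← ENNReal.ofReal_mul (by positivity), ← ENNReal.ofReal_mul (by positivity)]
  refine ENNReal.ofReal_le_ofReal ?_
  change X ^ 2 ≤ _
  linarith

end Transport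

/-! ### Energy dissipation and discrete Hölder estimates -/

section Discrete

variable {d : ℕ} {k : EuclideanSpace ℝ (Fin d) → ℝ} {E₀ : Set (EuclideanSpace ℝ (Fin d))} {h : ℝ}
  {E : ℕ → Set (EuclideanSpace ℝ (Fin d))}

theorem IsKernel.convIndicator_le_one (hk : IsKernel k) (A : Set (EuclideanSpace ℝ (Fin d)))
    (x : EuclideanSpace ℝ (Fin d)) : convIndicator k A x ≤ 1 := by
  refine (setLIntegral_le_lintegral _ _).trans ?_
  rw [lintegral_sub_left_eq_self (fun z => ENNReal.ofReal (k z)) x,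
    ← ofReal_integral_eq_lintegral_ofReal hk.integrable (Eventually.of_forall hk.nonneg),
    hk.integral_eq_one, ENNReal.ofReal_one]

theorem perimeter_le_energy (k : EuclideanSpace ℝ (Fin d) → ℝ)
    (A : Set (EuclideanSpace ℝ (Fin d))) : perimeter A ≤ energy k A :=
  le_self_add

theorem IsInitialCondition.volume_ne_top (hE₀ : IsInitialCondition E₀) : volume E₀ ≠ ∞ := by
  refine ne_top_of_le_ne_top hE₀.moment_lt_top.ne ?_
  rw [← setLIntegral_one]
  refine lintegral_mono fun x => ?_
  rw [← ENNReal.ofReal_one]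
  exact ENNReal.ofReal_le_ofReal (by nlinarith [sq_nonneg ‖x‖])

theorem IsInitialCondition.secondMoment_ne_top (hE₀ : IsInitialCondition E₀) :
    ∫⁻ x in E₀, ‖x‖ₑ ^ 2 ≠ ∞ := by
  refine ne_top_of_le_ne_top hE₀.moment_lt_top.ne ?_
  refine lintegral_mono fun x => ?_
  rw [← ofReal_norm, ← ENNReal.ofReal_pow (norm_nonneg _)]
  exact ENNReal.ofReal_le_ofReal (by linarith)

theorem IsInitialCondition.energy_ne_top (hE₀ : IsInitialCondition E₀) (hk : IsKernel k) :
    energy k E₀ ≠ ∞ := by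
  refine ENNReal.add_ne_top.2 ⟨hE₀.perimeter_lt_top.ne, ?_⟩
  refine ne_top_of_le_ne_top hE₀.volume_ne_top ?_
  rw [← setLIntegral_one]
  exact lintegral_mono fun x => hk.convIndicator_le_one _ x

/-- The previous set is itself a competitor, with zero transport cost. -/
theorem IsMinimizingMovement.step (hE : IsMinimizingMovement k h E₀ E) {n : ℕ}
    (hn : volume (E n) ≠ ∞) :
    W2sq (E (n + 1)) (E n) / ENNReal.ofReal (2 * h) + energy k (E (n + 1)) ≤ energy k (E n) := by
  have := hE.minimal n (E n) (hE.measurable n)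
  simpa only [stepFunctional, W2sq_self hn, ENNReal.zero_div, zero_add] using this

theorem volume_eq_of_step (hE₀ : energy k E₀ ≠ ∞) {A B : Set (EuclideanSpace ℝ (Fin d))}
    (hB : energy k B ≤ energy k E₀)
    (hstep : W2sq A B / ENNReal.ofReal (2 * h) + energy k A ≤ energy k B) :
    volume A = volume B := by
  refine volume_eq_of_W2sq_ne_top fun htop => ?_
  rw [htop, ENNReal.top_div_of_ne_top ENNReal.ofReal_ne_top, top_add, top_le_iff] at hstep
  exact hE₀ (top_le_iff.1 (hstep ▸ hB))

/-- The induction is joint: the step inequality needs finite volume, and conservation of volume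
needs the energy bound. -/
theorem IsMinimizingMovement.volume_energy (hE : IsMinimizingMovement k h E₀ E)
    (hk : IsKernel k) (hE₀ : IsInitialCondition E₀) (n : ℕ) :
    volume (E n) = volume E₀ ∧ energy k (E n) ≤ energy k E₀ := by
  induction n with
  | zero => simp [hE.init]
  | succ n ih =>
    have hstep := hE.step (n := n) (by rw [ih.1]; exact hE₀.volume_ne_top)
    exact ⟨(volume_eq_of_step (hE₀.energy_ne_top hk) ih.2 hstep).trans ih.1,
      (le_add_self.trans hstep).trans ih.2⟩

/-- The energy dissipation inequality of the scheme. -/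
theorem IsMinimizingMovement.sum_W2sq_le (hE : IsMinimizingMovement k h E₀ E)
    (hk : IsKernel k) (hE₀ : IsInitialCondition E₀) (n j : ℕ) :
    (∑ i ∈ Finset.range j, W2sq (E (n + i + 1)) (E (n + i))) / ENNReal.ofReal (2 * h)
      + energy k (E (n + j)) ≤ energy k (E n) := by
  induction j with
  | zero => simp
  | succ j ih =>
    have hstep := hE.step (n := n + j) (by
      rw [(hE.volume_energy hk hE₀ _).1]; exact hE₀.volume_ne_top)
    rw [Finset.sum_range_succ, ENNReal.add_div, add_assoc]
    exact (add_le_add_right hstep _).trans ih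

theorem W2_le_sum (E : ℕ → Set (EuclideanSpace ℝ (Fin d))) {n : ℕ} (hn : volume (E n) ≠ ∞)
    (j : ℕ) :
    W2 (E (n + j)) (E n) ≤ ∑ i ∈ Finset.range j, W2 (E (n + i + 1)) (E (n + i)) := by
  induction j with
  | zero => simp [W2, W2sq_self hn]
  | succ j ih =>
    rw [Finset.sum_range_succ, add_comm (∑ i ∈ _, _)]
    exact (W2_triangle _ (E (n + j)) _).trans (add_le_add_right ih _)

theorem IsMinimizingMovement.W2sq_le (hE : IsMinimizingMovement k h E₀ E) (hh : 0 < h)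
    (hk : IsKernel k) (hE₀ : IsInitialCondition E₀) (n j : ℕ) :
    W2sq (E (n + j)) (E n) ≤ ENNReal.ofReal (2 * (j * h)) * energy k E₀ := by
  have h1 : W2sq (E (n + j)) (E n) ≤
      (∑ i ∈ Finset.range j, W2 (E (n + i + 1)) (E (n + i))) ^ (2 : ℝ) := by
    rw [← W2_rpow_two]
    refine ENNReal.rpow_le_rpow (W2_le_sum E ?_ j) (by norm_num)
    rw [(hE.volume_energy hk hE₀ n).1]
    exact hE₀.volume_ne_top
  -- Cauchy-Schwarz over `j` increments; the factor `j` combines with `2h` from the dissipation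
  -- bound into `2 j h`.
  refine h1.trans ((ENNReal.rpow_sum_le_const_mul_sum_rpow _ _ (by norm_num)).trans ?_)
  simp only [W2_rpow_two, Finset.card_range]
  have h2 : ∑ i ∈ Finset.range j, W2sq (E (n + i + 1)) (E (n + i)) ≤
      energy k E₀ * ENNReal.ofReal (2 * h) := by
    rw [← ENNReal.div_le_iff_le_mul (Or.inl (ENNReal.ofReal_pos.2 (by positivity)).ne')
      (Or.inl ENNReal.ofReal_ne_top)]
    exact le_self_add.trans ((hE.sum_W2sq_le hk hE₀ n j).trans (hE.volume_energy hk hE₀ n).2)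
  calc (j : ℝ≥0∞) ^ ((2 : ℝ) - 1) * ∑ i ∈ Finset.range j, W2sq (E (n + i + 1)) (E (n + i))
      ≤ (j : ℝ≥0∞) ^ ((2 : ℝ) - 1) * (energy k E₀ * ENNReal.ofReal (2 * h)) := by gcongr
    _ = ENNReal.ofReal (2 * (j * h)) * energy k E₀ := by
        have : (2 : ℝ) * (j * h) = j * (2 * h) := by ring
        rw [this, ENNReal.ofReal_mul (p := (j : ℝ)) (by positivity), ENNReal.ofReal_natCast]
        norm_num
        ring

/-- The extra `h` is the rounding error of the two floors. -/
theorem exists_interpolate_eq (hh : 0 < h) (E : ℕ → Set (EuclideanSpace ℝ (Fin d))) {s t : ℝ}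
    (hs : 0 ≤ s) (hst : s ≤ t) :
    ∃ n j : ℕ, interpolate h E s = E n ∧ interpolate h E t = E (n + j) ∧ j * h ≤ t - s + h := by
  have hle : ⌊s / h⌋₊ ≤ ⌊t / h⌋₊ := Nat.floor_mono (by gcongr)
  refine ⟨⌊s / h⌋₊, ⌊t / h⌋₊ - ⌊s / h⌋₊, rfl, ?_, ?_⟩
  · rw [Nat.add_sub_cancel' hle]
    rfl
  · have h1 : (⌊t / h⌋₊ : ℝ) ≤ t / h := Nat.floor_le (div_nonneg (hs.trans hst) hh.le)
    have h2 : s / h < ⌊s / h⌋₊ + 1 := Nat.lt_floor_add_one _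
    rw [Nat.cast_sub hle, ← le_div_iff₀ hh, add_div, sub_div, div_self hh.ne']
    linarith

/-- The discrete Hölder estimates, up to one time step. -/
theorem exists_discrete_estimate (d : ℕ) : ∃ C : ℝ, 0 < C ∧
    ∀ (k : EuclideanSpace ℝ (Fin d) → ℝ), IsKernel k →
    ∀ (E₀ : Set (EuclideanSpace ℝ (Fin d))), IsInitialCondition E₀ →
    ∀ (h : ℝ), 0 < h → ∀ (E : ℕ → Set (EuclideanSpace ℝ (Fin d))),
      IsMinimizingMovement k h E₀ E → ∀ s t : ℝ, 0 ≤ s → s ≤ t →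
      W2 (interpolate h E t) (interpolate h E s) ≤
        ENNReal.ofReal C * energy k E₀ ^ (1 / 2 : ℝ) * ENNReal.ofReal (t - s + h) ^ (1 / 2 : ℝ) ∧
      volume (interpolate h E t ∆ interpolate h E s) ≤
        ENNReal.ofReal C * volume E₀ ^ (1 / 4 : ℝ) * energy k E₀ ^ (3 / 4 : ℝ)
          * ENNReal.ofReal (t - s + h) ^ (1 / 4 : ℝ) := by
  obtain ⟨C₀, hC₀, hint⟩ := exists_measure_symmDiff_sq_le d
  have hC' : 0 ≤ 2 * C₀ ^ (1 / 2 : ℝ) := by positivity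
  refine ⟨2 + 2 * C₀ ^ (1 / 2 : ℝ), by positivity, ?_⟩
  intro k hk E₀ hE₀ h hh E hE s t hs hst
  obtain ⟨n, j, hn, hj, hjh⟩ := exists_interpolate_eq hh E hs hst
  rw [hn, hj]
  set e := energy k E₀
  have he : e ≠ ∞ := hE₀.energy_ne_top hk
  set δ := ENNReal.ofReal (t - s + h)
  have hW2sq : W2sq (E (n + j)) (E n) ≤ 2 * δ * e := by
    refine (hE.W2sq_le hh hk hE₀ n j).trans ?_
    rw [ENNReal.ofReal_mul zero_le_two, ENNReal.ofReal_ofNat]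
    gcongr
    exact ENNReal.ofReal_le_ofReal hjh
  have htwo : ∀ a : ℝ, 0 < a → a ≤ 1 → (2 : ℝ≥0∞) ^ a ≤ 2 := by
    intro a ha ha1
    simpa using ENNReal.rpow_le_rpow_of_exponent_le (x := 2) (by norm_num) ha1
  have hW : W2 (E (n + j)) (E n) ≤ 2 ^ (1 / 2 : ℝ) * δ ^ (1 / 2 : ℝ) * e ^ (1 / 2 : ℝ) := by
    refine (ENNReal.rpow_le_rpow hW2sq (by norm_num)).trans (le_of_eq ?_)
    rw [ENNReal.mul_rpow_of_nonneg _ _ (by norm_num), ENNReal.mul_rpow_of_nonneg _ _ (by norm_num)]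
  have hWtop : W2 (E (n + j)) (E n) ≠ ∞ := by
    refine ne_top_of_le_ne_top ?_ hW
    finiteness
  constructor
  · calc W2 (E (n + j)) (E n) ≤ 2 ^ (1 / 2 : ℝ) * δ ^ (1 / 2 : ℝ) * e ^ (1 / 2 : ℝ) := hW
      _ ≤ 2 * δ ^ (1 / 2 : ℝ) * e ^ (1 / 2 : ℝ) := by
          gcongr
          exact htwo _ (by norm_num) (by norm_num)
      _ = ENNReal.ofReal 2 * e ^ (1 / 2 : ℝ) * δ ^ (1 / 2 : ℝ) := by
          rw [ENNReal.ofReal_ofNat]; ring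
      _ ≤ _ := by
          gcongr
          linarith
  · have hv : ∀ i, volume (E i) = volume E₀ := fun i => (hE.volume_energy hk hE₀ i).1
    have hP : ∀ i, perimeter (E i) ≤ e := fun i =>
      (perimeter_le_energy k _).trans (hE.volume_energy hk hE₀ i).2
    have h1 := hint (E (n + j)) (E n) (hE.measurable _) (hE.measurable _)
      (by rw [hv]; exact hE₀.volume_ne_top) hWtop e he (hP _) (hP _)
    rw [hv] at h1
    -- The square root of this bound yields the exponents: `3/4` for the energy from `e * e^{1/2}`,
    -- and `1/4` for the volume and the time increment.
    have h2 : volume (E (n + j) ∆ E n) ^ 2 ≤ ENNReal.ofReal C₀ * e * volume E₀ ^ (1 / 2 : ℝ) *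
        (2 ^ (1 / 2 : ℝ) * δ ^ (1 / 2 : ℝ) * e ^ (1 / 2 : ℝ)) := h1.trans (by gcongr)
    have h3 := ENNReal.rpow_le_rpow h2 (z := 1 / 2) (by norm_num)
    rw [← ENNReal.rpow_two, ← ENNReal.rpow_mul] at h3
    norm_num only at h3
    rw [ENNReal.rpow_one] at h3
    refine h3.trans ?_
    simp only [ENNReal.mul_rpow_of_nonneg _ _ (show (0 : ℝ) ≤ 1 / 2 by norm_num),
      ← ENNReal.rpow_mul]
    have h34 : e ^ (3 / 4 : ℝ) = e ^ (1 / 2 : ℝ) * e ^ (1 / 4 : ℝ) := by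
      rw [← ENNReal.rpow_add_of_nonneg _ _ (by norm_num) (by norm_num)]
      norm_num
    rw [h34, ENNReal.ofReal_rpow_of_pos hC₀]
    norm_num only
    calc ENNReal.ofReal (C₀ ^ (1 / 2 : ℝ)) * e ^ (1 / 2 : ℝ) * volume E₀ ^ (1 / 4 : ℝ) *
          (2 ^ (1 / 4 : ℝ) * δ ^ (1 / 4 : ℝ) * e ^ (1 / 4 : ℝ))
        = 2 ^ (1 / 4 : ℝ) * ENNReal.ofReal (C₀ ^ (1 / 2 : ℝ)) * volume E₀ ^ (1 / 4 : ℝ) *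
          (e ^ (1 / 2 : ℝ) * e ^ (1 / 4 : ℝ)) * δ ^ (1 / 4 : ℝ) := by ring
      _ ≤ 2 * ENNReal.ofReal (C₀ ^ (1 / 2 : ℝ)) * volume E₀ ^ (1 / 4 : ℝ) *
          (e ^ (1 / 2 : ℝ) * e ^ (1 / 4 : ℝ)) * δ ^ (1 / 4 : ℝ) := by
          gcongr
          exact htwo _ (by norm_num) (by norm_num)
      _ = ENNReal.ofReal (2 * C₀ ^ (1 / 2 : ℝ)) * volume E₀ ^ (1 / 4 : ℝ) *
          (e ^ (1 / 2 : ℝ) * e ^ (1 / 4 : ℝ)) * δ ^ (1 / 4 : ℝ) := by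
          rw [ENNReal.ofReal_mul zero_le_two, ENNReal.ofReal_ofNat]
      _ ≤ _ := by
          gcongr
          linarith

end Discrete

/-! ### Convergence in measure of sets -/

section Completeness

variable {V : Type*} [MeasurableSpace V] {μ : Measure V}

theorem measure_symmDiff_triangle (A B C : Set V) : μ (A ∆ C) ≤ μ (A ∆ B) + μ (B ∆ C) :=
  (measure_mono (symmDiff_triangle A B C)).trans (measure_union_le _ _)

/-- The space of measurable sets is complete for the distance `μ (A ∆ B)`. -/
theorem exists_tendsto_measure_symmDiff {A : ℕ → Set V} (hA : ∀ n, NullMeasurableSet (A n) μ)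
    (hc : ∀ ε : ℝ≥0∞, 0 < ε → ∃ N, ∀ i ≥ N, ∀ j ≥ N, μ (A i ∆ A j) ≤ ε) :
    ∃ B : Set V, MeasurableSet B ∧ Tendsto (fun n => μ (A n ∆ B)) atTop (𝓝 0) := by
  choose A' _ hA' hAA using fun n => (hA n).exists_measurable_superset_ae_eq
  have hcongr : ∀ i j, μ (A i ∆ A j) = μ (A' i ∆ A' j) := fun i j =>
    measure_symmDiff_congr (hAA i).symm (hAA j).symm
  have hpow : ∀ n : ℕ, (0 : ℝ≥0∞) < (2⁻¹ : ℝ≥0∞) ^ n := fun n =>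
    ENNReal.pow_pos (by simp) n
  choose N hN using fun n : ℕ => hc ((2⁻¹ : ℝ≥0∞) ^ n) (hpow n)
  -- Partial sums make the indices monotone while keeping `N n ≤ ψ n`.
  let ψ : ℕ → ℕ := fun n => ∑ i ∈ Finset.range (n + 1), N i
  have hψN : ∀ n, N n ≤ ψ n := fun n =>
    Finset.single_le_sum (f := N) (fun _ _ => Nat.zero_le _) (Finset.self_mem_range_succ n)
  have hψ : ∀ n, ψ n ≤ ψ (n + 1) := fun n => by
    simp only [ψ, Finset.sum_range_succ _ (n + 1)]
    exact Nat.le_add_right _ _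
  have hD : ∀ n, μ (A' (ψ n) ∆ A' (ψ (n + 1))) ≤ (2⁻¹ : ℝ≥0∞) ^ n := fun n => by
    rw [← hcongr]
    exact hN n _ (hψN n) _ ((hψN n).trans (hψ n))
  -- The limit is the limsup along `ψ`. A point outside all consecutive differences from stage `n`
  -- on never changes membership, which bounds the error by a geometric tail.
  let B : Set V := ⋂ n, ⋃ i, A' (ψ (n + i))
  have hsub : ∀ n, A' (ψ n) ∆ B ⊆ ⋃ i, A' (ψ (n + i)) ∆ A' (ψ (n + i + 1)) := by
    intro n x hx
    by_contra hcon
    simp only [Set.mem_iUnion, not_exists] at hcon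
    have hconst : ∀ i, x ∈ A' (ψ (n + i)) ↔ x ∈ A' (ψ n) := by
      intro i
      induction i with
      | zero => rfl
      | succ i ih =>
        rw [← ih]
        have := hcon i
        rw [Set.mem_symmDiff] at this
        rw [← add_assoc]
        tauto
    have hB : x ∈ B ↔ x ∈ A' (ψ n) := by
      simp only [B, Set.mem_iInter, Set.mem_iUnion]
      constructor
      · intro h
        obtain ⟨i, hi⟩ := h n
        exact (hconst i).1 hi
      · intro h m
        exact ⟨n, by rw [add_comm]; exact (hconst m).2 h⟩
    rw [Set.mem_symmDiff] at hx
    tauto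
  have htail : ∀ n, μ (A' (ψ n) ∆ B) ≤ ∑' i, (2⁻¹ : ℝ≥0∞) ^ (i + n) := fun n =>
    (measure_mono (hsub n)).trans ((measure_iUnion_le _).trans
      (ENNReal.tsum_le_tsum fun i => (hD (n + i)).trans_eq (by rw [add_comm])))
  have htail0 : Tendsto (fun n => ∑' i, (2⁻¹ : ℝ≥0∞) ^ (i + n)) atTop (𝓝 0) := by
    refine ENNReal.tendsto_sum_nat_add (fun i => (2⁻¹ : ℝ≥0∞) ^ i) ?_
    rw [ENNReal.tsum_geometric]
    simp
  refine ⟨B, MeasurableSet.iInter fun n => MeasurableSet.iUnion fun i => hA' _, ?_⟩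
  rw [ENNReal.tendsto_atTop_zero]
  intro ε hε
  have hε2 : 0 < ε / 2 := ENNReal.half_pos hε.ne'
  obtain ⟨N₁, hN₁⟩ := hc (ε / 2) hε2
  obtain ⟨N₂, hN₂⟩ := (ENNReal.tendsto_atTop_zero.1 htail0) (ε / 2) hε2
  obtain ⟨N₃, hN₃⟩ := (ENNReal.tendsto_atTop_zero.1
    (ENNReal.tendsto_pow_atTop_nhds_zero_of_lt_one (r := 2⁻¹) (by simp))) (ε / 2) hε2
  refine ⟨N (max N₂ N₃), fun n hn => ?_⟩
  have h1 : μ (A n ∆ A (ψ (max N₂ N₃))) ≤ ε / 2 :=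
    (hN _ n hn _ (hψN _)).trans (hN₃ _ (le_max_right _ _))
  have h2 : μ (A (ψ (max N₂ N₃)) ∆ B) ≤ ε / 2 := by
    rw [measure_symmDiff_congr (hAA _).symm (ae_eq_refl B)]
    exact (htail _).trans (hN₂ _ (le_max_left _ _))
  calc μ (A n ∆ B) ≤ _ := measure_symmDiff_triangle _ (A (ψ (max N₂ N₃))) _
    _ ≤ ε / 2 + ε / 2 := add_le_add h1 h2
    _ = ε := ENNReal.add_halves ε

theorem abs_setIntegral_sub_setIntegral_le {A B : Set V} (hA : NullMeasurableSet A μ)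
    (hB : NullMeasurableSet B μ) (hAB : μ (A ∆ B) ≠ ∞) {f : V → ℝ} (hf : Integrable f μ) {M : ℝ}
    (hM : ∀ x, |f x| ≤ M) : |(∫ x in A, f x ∂μ) - ∫ x in B, f x ∂μ| ≤ M * μ.real (A ∆ B) := by
  have h1 := integral_inter_add_sdiff₀ hB (hf.integrableOn (s := A))
  have h2 := integral_inter_add_sdiff₀ hA (hf.integrableOn (s := B))
  rw [Set.inter_comm] at h2
  have hAB' : μ (A \ B) ≠ ∞ := measure_ne_top_of_subset Set.subset_union_left hAB
  have hBA' : μ (B \ A) ≠ ∞ := measure_ne_top_of_subset Set.subset_union_right hAB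
  have h3 := norm_setIntegral_le_of_norm_le_const (μ := μ) (s := A \ B) (f := f) (C := M)
      hAB'.lt_top (fun x _ => hM x)
  have h4 := norm_setIntegral_le_of_norm_le_const (μ := μ) (s := B \ A) (f := f) (C := M)
      hBA'.lt_top (fun x _ => hM x)
  have h5 : μ.real (A ∆ B) = μ.real (A \ B) + μ.real (B \ A) :=
    measureReal_union₀ (hB.diff hA)
      (Set.disjoint_left.2 fun x hx hx' => hx.2 hx'.1).aedisjoint hAB' hBA'
  rw [h5]
  rw [Real.norm_eq_abs] at h3 h4
  rw [abs_le] at *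
  constructor <;> linarith [h3.1, h3.2, h4.1, h4.2]

theorem tendsto_setIntegral_of_symmDiff {A : ℕ → Set V} {B : Set V}
    (hA : ∀ n, NullMeasurableSet (A n) μ) (hB : NullMeasurableSet B μ)
    (hAB : Tendsto (fun n => μ (A n ∆ B)) atTop (𝓝 0)) {f : V → ℝ} (hf : Integrable f μ) {M : ℝ}
    (hM : ∀ x, |f x| ≤ M) :
    Tendsto (fun n => ∫ x in A n, f x ∂μ) atTop (𝓝 (∫ x in B, f x ∂μ)) := by
  rw [tendsto_iff_dist_tendsto_zero]
  have h0 : Tendsto (fun n => M * μ.real (A n ∆ B)) atTop (𝓝 0) := by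
    simpa [Measure.real] using ((ENNReal.tendsto_toReal ENNReal.zero_ne_top).comp hAB).const_mul M
  refine tendsto_of_tendsto_of_tendsto_of_le_of_le' tendsto_const_nhds h0
    (Eventually.of_forall fun n => dist_nonneg) ?_
  filter_upwards [hAB.eventually_lt_const ENNReal.zero_lt_top] with n hn
  exact abs_setIntegral_sub_setIntegral_le (hA n) hB hn.ne hf hM

/-- Absolute continuity of the integral, uniform over all `ρ ≤ μ` of small mass: the part of `f`
above a level `n` has small integral, and the rest is at most `n`. It will control the second
moments of the remainders in repaired transport plans. -/
theorem exists_forall_lintegral_le {f : V → ℝ≥0∞} (hf : Measurable f) (hfin : ∀ x, f x ≠ ∞)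
    (hint : ∫⁻ x, f x ∂μ ≠ ∞) {ε : ℝ≥0∞} (hε : 0 < ε) :
    ∃ δ : ℝ≥0∞, 0 < δ ∧ ∀ ρ : Measure V, ρ ≤ μ → ρ Set.univ ≤ δ → ∫⁻ x, f x ∂ρ ≤ ε := by
  have hlim : Tendsto (fun n : ℕ => ∫⁻ x, (f x - n) ∂μ) atTop (𝓝 (∫⁻ _, 0 ∂μ)) := by
    refine tendsto_lintegral_of_dominated_convergence f (fun n => by fun_prop)
      (fun n => Eventually.of_forall fun x => tsub_le_self) hint (Eventually.of_forall fun x => ?_)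
    obtain ⟨N, hN⟩ := ENNReal.exists_nat_gt (hfin x)
    refine tendsto_const_nhds.congr' ?_
    filter_upwards [eventually_ge_atTop N] with n hn
    exact (tsub_eq_zero_of_le (hN.le.trans (by exact_mod_cast hn))).symm
  rw [lintegral_zero] at hlim
  obtain ⟨n, hn⟩ := (hlim.eventually_le_const (ENNReal.half_pos hε.ne')).exists
  have hn1 : (n : ℝ≥0∞) + 1 ≠ ∞ := by finiteness
  refine ⟨ε / 2 / (n + 1), ENNReal.div_pos (ENNReal.half_pos hε.ne').ne' hn1,
    fun ρ hρ hρδ => ?_⟩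
  calc ∫⁻ x, f x ∂ρ ≤ ∫⁻ x, ((f x - n) + n) ∂ρ := lintegral_mono fun x => le_tsub_add
    _ = ∫⁻ x, (f x - n) ∂ρ + n * ρ Set.univ := by
        rw [lintegral_add_right _ measurable_const, lintegral_const]
    _ ≤ ∫⁻ x, (f x - n) ∂μ + (n + 1) * (ε / 2 / (n + 1)) := by
        gcongr
        exact le_self_add
    _ ≤ ε / 2 + ε / 2 := by
        gcongr
        exact ENNReal.mul_div_le
    _ = ε := ENNReal.add_halves ε

/-- Lower semicontinuity of integrals of non-negative functions. -/
theorem setLIntegral_le_of_tendsto_symmDiff {A : ℕ → Set V} {B : Set V}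
    (hAB : Tendsto (fun n => μ (A n ∆ B)) atTop (𝓝 0)) {f : V → ℝ≥0∞} (hf : Measurable f)
    {M : ℝ≥0∞} (hM : ∀ n, ∫⁻ x in A n, f x ∂μ ≤ M) : ∫⁻ x in B, f x ∂μ ≤ M := by
  have htrunc : ∀ R : ℕ, ∫⁻ x in B, min (f x) R ∂μ ≤ M := by
    intro R
    have h1 : ∀ n, ∫⁻ x in B, min (f x) R ∂μ ≤ M + R * μ (A n ∆ B) := by
      intro n
      have hsub : B ⊆ A n ∪ A n ∆ B := fun x hx => by
        by_cases hxA : x ∈ A n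
        · exact Or.inl hxA
        · exact Or.inr (Or.inr ⟨hx, hxA⟩)
      calc ∫⁻ x in B, min (f x) R ∂μ ≤ ∫⁻ x in A n ∪ A n ∆ B, min (f x) R ∂μ :=
            lintegral_mono_set hsub
        _ ≤ ∫⁻ x in A n, min (f x) R ∂μ + ∫⁻ x in A n ∆ B, min (f x) R ∂μ :=
            lintegral_union_le _ _ _
        _ ≤ ∫⁻ x in A n, f x ∂μ + ∫⁻ _ in A n ∆ B, R ∂μ :=
            add_le_add (lintegral_mono fun x => min_le_left _ _)
              (lintegral_mono fun x => min_le_right _ _)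
        _ ≤ M + R * μ (A n ∆ B) := by
            rw [setLIntegral_const]
            gcongr
            exact hM n
    have h2 : Tendsto (fun n => M + R * μ (A n ∆ B)) atTop (𝓝 (M + R * 0)) :=
      (ENNReal.Tendsto.const_mul hAB (Or.inr (by finiteness))).const_add M
    simpa using ge_of_tendsto' h2 h1
  have hlim : Tendsto (fun R : ℕ => ∫⁻ x in B, min (f x) R ∂μ) atTop (𝓝 (∫⁻ x in B, f x ∂μ)) := by
    refine lintegral_tendsto_of_tendsto_of_monotone (fun R => by fun_prop)
      (Eventually.of_forall fun x => ?_) (Eventually.of_forall fun x => ?_)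
    · intro a b hab
      exact min_le_min_left _ (by exact_mod_cast hab)
    · simpa using (tendsto_const_nhds (x := f x)).min ENNReal.tendsto_nat_nhds_top
  exact le_of_tendsto' hlim htrunc

end Completeness

/-! ### Lower semicontinuity of the perimeter and of `W_2` -/

section LowerSemicontinuity

variable {d : ℕ}

theorem continuous_divergence {ξ : EuclideanSpace ℝ (Fin d) → EuclideanSpace ℝ (Fin d)}
    (hξ : ContDiff ℝ 1 ξ) : Continuous (divergence ξ) := by
  have hf : Continuous (fderiv ℝ ξ) := hξ.continuous_fderiv one_ne_zero
  unfold divergence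
  fun_prop

theorem hasCompactSupport_divergence {ξ : EuclideanSpace ℝ (Fin d) → EuclideanSpace ℝ (Fin d)}
    (hc : HasCompactSupport ξ) : HasCompactSupport (divergence ξ) :=
  (hc.fderiv ℝ).comp_left
    (g := fun T : EuclideanSpace ℝ (Fin d) →L[ℝ] EuclideanSpace ℝ (Fin d) =>
      ∑ i, T (EuclideanSpace.single i 1) i) (by simp)

/-- Lower semicontinuity of the perimeter. -/
theorem perimeter_le_of_tendsto_symmDiff {A : ℕ → Set (EuclideanSpace ℝ (Fin d))}
    {B : Set (EuclideanSpace ℝ (Fin d))} (hA : ∀ n, NullMeasurableSet (A n))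
    (hB : NullMeasurableSet B) (hAB : Tendsto (fun n => volume (A n ∆ B)) atTop (𝓝 0))
    {P : ℝ≥0∞} (hP : ∀ n, perimeter (A n) ≤ P) : perimeter B ≤ P := by
  refine iSup_le fun ξ => iSup_le fun hξ => iSup_le fun hc => iSup_le fun h1 => ?_
  have hcont := continuous_divergence hξ
  have hcs := hasCompactSupport_divergence hc
  obtain ⟨M, hM⟩ := hcs.exists_bound_of_continuous hcont
  have hlim := tendsto_setIntegral_of_symmDiff hA hB hAB
    (hcont.integrable_of_hasCompactSupport hcs) hM
  refine le_of_tendsto' (ENNReal.tendsto_ofReal hlim.neg) fun n => le_trans ?_ (hP n)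
  exact le_iSup_of_le ξ (le_iSup_of_le hξ (le_iSup_of_le hc (le_iSup_of_le h1 le_rfl)))

/-- The product coupling of two measures of equal mass. -/
theorem exists_coupling (μ ν : Measure (EuclideanSpace ℝ (Fin d))) [IsFiniteMeasure μ]
    [IsFiniteMeasure ν] (hμν : μ Set.univ = ν Set.univ) :
    ∃ π : Measure (EuclideanSpace ℝ (Fin d) × EuclideanSpace ℝ (Fin d)), IsFiniteMeasure π ∧
      π.map Prod.fst = μ ∧ π.map Prod.snd = ν ∧
      ∫⁻ p, ‖p.1 - p.2‖ₑ ^ 2 ∂π ≤ 2 * (∫⁻ x, ‖x‖ₑ ^ 2 ∂μ) + 2 * (∫⁻ x, ‖x‖ₑ ^ 2 ∂ν) := by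
  rcases eq_or_ne (μ Set.univ) 0 with h0 | h0
  · have hμ : μ = 0 := Measure.measure_univ_eq_zero.1 h0
    have hν : ν = 0 := Measure.measure_univ_eq_zero.1 (hμν ▸ h0)
    exact ⟨0, inferInstance, by simp [hμ], by simp [hν], by simp⟩
  have hinv : (μ Set.univ)⁻¹ * μ Set.univ = 1 := ENNReal.inv_mul_cancel h0 (measure_ne_top _ _)
  have hinv' : (μ Set.univ)⁻¹ * ν Set.univ = 1 := hμν ▸ hinv
  refine ⟨(μ Set.univ)⁻¹ • μ.prod ν, ?_, ?_, ?_, ?_⟩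
  · exact Measure.smul_finite _ (ENNReal.inv_ne_top.2 h0)
  · rw [Measure.map_smul, Measure.map_fst_prod, smul_smul, hinv', one_smul]
  · rw [Measure.map_smul, Measure.map_snd_prod, smul_smul, hinv, one_smul]
  · rw [lintegral_smul_measure]
    have hle : ∫⁻ p, ‖p.1 - p.2‖ₑ ^ 2 ∂(μ.prod ν) ≤
        ∫⁻ p, (2 * ‖p.1‖ₑ ^ 2 + 2 * ‖p.2‖ₑ ^ 2) ∂(μ.prod ν) := by
      refine lintegral_mono fun p => ?_
      refine (pow_le_pow_left' (enorm_sub_le (a := p.1) (b := p.2)) 2).trans ?_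
      have := ENNReal.rpow_add_le_mul_rpow_add_rpow ‖p.1‖ₑ ‖p.2‖ₑ (p := 2) (by norm_num)
      norm_num at this
      rwa [mul_add] at this
    have h1 : ∫⁻ p, 2 * ‖p.1‖ₑ ^ 2 ∂(μ.prod ν) = ν Set.univ * (2 * ∫⁻ x, ‖x‖ₑ ^ 2 ∂μ) := by
      rw [← lintegral_map (f := fun x => 2 * ‖x‖ₑ ^ 2) (by fun_prop) measurable_fst,
        Measure.map_fst_prod, lintegral_smul_measure, lintegral_const_mul _ (by fun_prop),
        smul_eq_mul]
    have h2 : ∫⁻ p, 2 * ‖p.2‖ₑ ^ 2 ∂(μ.prod ν) = μ Set.univ * (2 * ∫⁻ x, ‖x‖ₑ ^ 2 ∂ν) := by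
      rw [← lintegral_map (f := fun x => 2 * ‖x‖ₑ ^ 2) (by fun_prop) measurable_snd,
        Measure.map_snd_prod, lintegral_smul_measure, lintegral_const_mul _ (by fun_prop),
        smul_eq_mul]
    rw [lintegral_add_left (by fun_prop), h1, h2] at hle
    rw [smul_eq_mul]
    refine (mul_le_mul_right hle _).trans (le_of_eq ?_)
    rw [mul_add, ← mul_assoc (_⁻¹) (ν _), ← mul_assoc (_⁻¹) (μ _), hinv, hinv', one_mul, one_mul]

/-- A transport plan for `(A, B)` can be modified into one for `(E, F)`; the additional cost only
involves the second moments of two small remainders. -/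
theorem IsTransportPlan.W2sq_le_add {A B E F : Set (EuclideanSpace ℝ (Fin d))}
    {γ : Measure (EuclideanSpace ℝ (Fin d) × EuclideanSpace ℝ (Fin d))}
    (hγ : IsTransportPlan A B γ) (hE : MeasurableSet E) (hF : MeasurableSet F)
    (hAE : volume A = volume E) (hBF : volume B = volume F) :
    ∃ ρ σ : Measure (EuclideanSpace ℝ (Fin d)), ρ ≤ volume.restrict E ∧ σ ≤ volume.restrict F ∧
      ρ Set.univ ≤ volume (A ∆ E) + volume (B ∆ F) ∧
      σ Set.univ ≤ volume (A ∆ E) + volume (B ∆ F) ∧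
      W2sq E F ≤ ∫⁻ p, ‖p.1 - p.2‖ₑ ^ 2 ∂γ +
        (2 * (∫⁻ x, ‖x‖ₑ ^ 2 ∂ρ) + 2 * (∫⁻ x, ‖x‖ₑ ^ 2 ∂σ)) := by
  have := hγ.1
  have hEfin : IsFiniteMeasure (volume.restrict E) :=
    ⟨by rw [Measure.restrict_apply_univ, ← hAE, ← hγ.measure_univ_left]; exact measure_lt_top _ _⟩
  have hFfin : IsFiniteMeasure (volume.restrict F) :=
    ⟨by rw [Measure.restrict_apply_univ, ← hBF, ← hγ.measure_univ_right]; exact measure_lt_top _ _⟩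
  -- The part of `γ` living on `E ×ˢ F` is kept. Its marginals fall short of those required by equal
  -- masses, and these deficits are coupled by a normalized product measure.
  set S : Set (EuclideanSpace ℝ (Fin d) × EuclideanSpace ℝ (Fin d)) := E ×ˢ F
  have hS : MeasurableSet S := hE.prod hF
  set μ₁ := (γ.restrict S).map Prod.fst
  set μ₂ := (γ.restrict S).map Prod.snd
  have hμ₁ : μ₁ ≤ volume.restrict E := by
    refine Measure.le_iff.2 fun s hs => ?_
    rw [Measure.map_apply measurable_fst hs, Measure.restrict_apply (measurable_fst hs),
      Measure.restrict_apply hs]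
    refine (measure_mono (t := Prod.fst ⁻¹' (s ∩ E)) fun p hp => ⟨hp.1, hp.2.1⟩).trans ?_
    rw [← Measure.map_apply measurable_fst (hs.inter hE), hγ.2.1]
    exact Measure.restrict_apply_le _ _
  have hμ₂ : μ₂ ≤ volume.restrict F := by
    refine Measure.le_iff.2 fun s hs => ?_
    rw [Measure.map_apply measurable_snd hs, Measure.restrict_apply (measurable_snd hs),
      Measure.restrict_apply hs]
    refine (measure_mono (t := Prod.snd ⁻¹' (s ∩ F)) fun p hp => ⟨hp.1, hp.2.2⟩).trans ?_
    rw [← Measure.map_apply measurable_snd (hs.inter hF), hγ.2.2]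
    exact Measure.restrict_apply_le _ _
  have hmass₁ : μ₁ Set.univ = γ S := by
    rw [Measure.map_apply measurable_fst MeasurableSet.univ]
    simp
  have hmass₂ : μ₂ Set.univ = γ S := by
    rw [Measure.map_apply measurable_snd MeasurableSet.univ]
    simp
  have hrem : γ Set.univ - γ S ≤ volume (A ∆ E) + volume (B ∆ F) := by
    rw [← measure_compl hS (measure_ne_top _ _)]
    have hsub : Sᶜ ⊆ Prod.fst ⁻¹' Eᶜ ∪ Prod.snd ⁻¹' Fᶜ := by
      intro p hp
      simp only [S, Set.mem_compl_iff, Set.mem_prod, not_and_or] at hp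
      exact hp
    refine (measure_mono hsub).trans ((measure_union_le _ _).trans ?_)
    rw [← Measure.map_apply measurable_fst hE.compl, ← Measure.map_apply measurable_snd hF.compl,
      hγ.2.1, hγ.2.2, Measure.restrict_apply hE.compl, Measure.restrict_apply hF.compl]
    gcongr
    · exact fun x hx => Or.inl ⟨hx.2, hx.1⟩
    · exact fun x hx => Or.inl ⟨hx.2, hx.1⟩
  have hρ : (volume.restrict E - μ₁) Set.univ = γ Set.univ - γ S := by
    rw [Measure.sub_apply MeasurableSet.univ hμ₁, hmass₁, Measure.restrict_apply_univ, ← hAE,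
      hγ.measure_univ_left]
  have hσ : (volume.restrict F - μ₂) Set.univ = γ Set.univ - γ S := by
    rw [Measure.sub_apply MeasurableSet.univ hμ₂, hmass₂, Measure.restrict_apply_univ, ← hBF,
      hγ.measure_univ_right]
  refine ⟨volume.restrict E - μ₁, volume.restrict F - μ₂, Measure.sub_le, Measure.sub_le,
    hρ.trans_le hrem, hσ.trans_le hrem, ?_⟩
  obtain ⟨π, hπ, hπ₁, hπ₂, hcost⟩ := exists_coupling _ _ (hρ.trans hσ.symm)
  have hplan : IsTransportPlan E F (γ.restrict S + π) := by
    refine ⟨inferInstance, ?_, ?_⟩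
    · rw [Measure.map_add _ _ measurable_fst, hπ₁, add_comm]
      exact Measure.sub_add_cancel_of_le hμ₁
    · rw [Measure.map_add _ _ measurable_snd, hπ₂, add_comm]
      exact Measure.sub_add_cancel_of_le hμ₂
  refine hplan.W2sq_le.trans ?_
  rw [lintegral_add_measure]
  exact add_le_add (setLIntegral_le_lintegral _ _) hcost

/-- Lower semicontinuity of the Wasserstein distance under `L^1` convergence. -/
theorem W2sq_le_of_tendsto_symmDiff {A B : ℕ → Set (EuclideanSpace ℝ (Fin d))}
    {E F : Set (EuclideanSpace ℝ (Fin d))} (hE : MeasurableSet E) (hF : MeasurableSet F)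
    (hAE : Tendsto (fun n => volume (A n ∆ E)) atTop (𝓝 0))
    (hBF : Tendsto (fun n => volume (B n ∆ F)) atTop (𝓝 0))
    (hvA : ∀ n, volume (A n) = volume E) (hvB : ∀ n, volume (B n) = volume F)
    (hmE : ∫⁻ x in E, ‖x‖ₑ ^ 2 ≠ ∞) (hmF : ∫⁻ x in F, ‖x‖ₑ ^ 2 ≠ ∞) {w : ℕ → ℝ≥0∞} {w₀ : ℝ≥0∞}
    (hw : Tendsto w atTop (𝓝 w₀)) (hle : ∀ᶠ n in atTop, W2sq (A n) (B n) ≤ w n) :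
    W2sq E F ≤ w₀ := by
  rcases eq_or_ne w₀ ∞ with rfl | hw₀
  · exact le_top
  refine ENNReal.le_of_forall_pos_le_add fun ε hε _ => ?_
  -- One share pays for near-optimality of the plan and four for the second moments of the two
  -- remainders.
  have hε' : (0 : ℝ≥0∞) < ε / 6 := ENNReal.div_pos (by simpa using hε.ne') (by simp)
  have hfin : ∀ x : EuclideanSpace ℝ (Fin d), ‖x‖ₑ ^ 2 ≠ ∞ := fun x => by finiteness
  obtain ⟨δ₁, hδ₁, h₁⟩ := exists_forall_lintegral_le (by fun_prop) hfin hmE hε'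
  obtain ⟨δ₂, hδ₂, h₂⟩ := exists_forall_lintegral_le (by fun_prop) hfin hmF hε'
  have hsum : Tendsto (fun n => volume (A n ∆ E) + volume (B n ∆ F)) atTop (𝓝 0) := by
    simpa using hAE.add hBF
  have hlt : w₀ < w₀ + ε / 6 := ENNReal.lt_add_right hw₀ hε'.ne'
  obtain ⟨n, hn, hn₁, hn₂, hn₃⟩ := (hle.and ((hsum.eventually_le_const hδ₁).and
    ((hsum.eventually_le_const hδ₂).and (hw.eventually_lt_const hlt)))).exists
  obtain ⟨γ, hγ, hcost⟩ := exists_isTransportPlan_of_W2sq_lt (hn.trans_lt hn₃)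
  obtain ⟨ρ, σ, hρE, hσF, hρ, hσ, hW⟩ := hγ.W2sq_le_add hE hF (hvA n) (hvB n)
  refine hW.trans ?_
  calc _ ≤ (w₀ + ε / 6) + (2 * (ε / 6) + 2 * (ε / 6)) := by
        gcongr
        · exact h₁ ρ hρE (hρ.trans hn₁)
        · exact h₂ σ hσF (hσ.trans hn₂)
    _ = w₀ + 5 * ((ε : ℝ≥0∞) / 6) := by ring
    _ ≤ w₀ + 6 * ((ε : ℝ≥0∞) / 6) := by
        gcongr
        norm_num
    _ = w₀ + ε := by
        rw [ENNReal.mul_div_cancel (by simp) (by simp)]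

end LowerSemicontinuity

/-! ### Testing measures on the cells of a partition -/

section Partition

variable {V : Type*} [MeasurableSpace V]

/-- Two finite measures tested against a bounded function which is almost constant on the pieces
of a partition. -/
theorem integral_sub_integral_le_of_partition {ν ν' : Measure V} [IsFiniteMeasure ν]
    [IsFiniteMeasure ν'] {Q : ℕ → Set V} (hQ : ∀ i, MeasurableSet (Q i))
    (hdisj : Pairwise fun i j => Disjoint (Q i) (Q j)) (I : ℕ) {g : V → ℝ}
    (hg : Measurable g) (hg1 : ∀ x, |g x| ≤ 1) {c : ℝ} (hc : 0 ≤ c) {a : ℕ → ℝ}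
    (ha : ∀ i, |a i| ≤ 1) (hgc : ∀ i, ∀ y ∈ Q i, |g y - a i| ≤ c) :
    (∫ x, g x ∂ν) - ∫ x, g x ∂ν' ≤ c * (ν.real Set.univ + ν'.real Set.univ)
      + ∑ i ∈ Finset.range I, |ν.real (Q i) - ν'.real (Q i)|
      + (ν.real (⋃ i ∈ Finset.range I, Q i)ᶜ + ν'.real (⋃ i ∈ Finset.range I, Q i)ᶜ) := by
  set U := ⋃ i ∈ Finset.range I, Q i with hU
  have hUm : MeasurableSet U := Finset.measurableSet_biUnion _ fun i _ => hQ i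
  have key : ∀ (τ : Measure V) [IsFiniteMeasure τ],
      |(∫ x, g x ∂τ) - ∑ i ∈ Finset.range I, a i * τ.real (Q i)| ≤
        c * τ.real Set.univ + τ.real Uᶜ := by
    intro τ _
    have hint : Integrable g τ :=
      Integrable.of_bound hg.aestronglyMeasurable 1 (Eventually.of_forall hg1)
    have h1 : ∫ x, g x ∂τ = (∑ i ∈ Finset.range I, ∫ x in Q i, g x ∂τ) + ∫ x in Uᶜ, g x ∂τ := by
      rw [← integral_add_compl hUm hint, hU, integral_biUnion_finset _ (fun i _ => hQ i)
        (fun i _ j _ hij => hdisj hij) (fun i _ => hint.integrableOn)]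
    have h2 : ∀ i, |(∫ x in Q i, g x ∂τ) - a i * τ.real (Q i)| ≤ c * τ.real (Q i) := by
      intro i
      have h3 := norm_setIntegral_le_of_norm_le_const (μ := τ) (s := Q i)
        (f := fun x => g x - a i) (measure_lt_top _ _) (fun x hx => hgc i x hx)
      rwa [integral_sub hint.integrableOn (integrable_const _), setIntegral_const, smul_eq_mul,
        mul_comm (τ.real _) (a i), Real.norm_eq_abs] at h3
    have h4 : |∫ x in Uᶜ, g x ∂τ| ≤ τ.real Uᶜ := by
      have := norm_setIntegral_le_of_norm_le_const (μ := τ) (s := Uᶜ)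
        (f := g) (measure_lt_top _ _) (fun x _ => hg1 x)
      rwa [one_mul] at this
    have h5 : ∑ i ∈ Finset.range I, τ.real (Q i) ≤ τ.real Set.univ := by
      rw [← measureReal_biUnion_finset (fun i _ j _ hij => hdisj hij) (fun i _ => hQ i)]
      exact measureReal_mono (Set.subset_univ _)
    rw [h1, add_sub_right_comm, ← Finset.sum_sub_distrib]
    refine (abs_add_le _ _).trans (add_le_add ?_ h4)
    refine (Finset.abs_sum_le_sum_abs _ _).trans ((Finset.sum_le_sum fun i _ => h2 i).trans ?_)
    rw [← Finset.mul_sum]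
    exact mul_le_mul_of_nonneg_left h5 hc
  have hsum : (∑ i ∈ Finset.range I, a i * ν.real (Q i)) -
      ∑ i ∈ Finset.range I, a i * ν'.real (Q i) ≤
      ∑ i ∈ Finset.range I, |ν.real (Q i) - ν'.real (Q i)| := by
    rw [← Finset.sum_sub_distrib]
    refine Finset.sum_le_sum fun i _ => ?_
    rw [← mul_sub]
    refine (le_abs_self _).trans ?_
    rw [abs_mul]
    exact mul_le_of_le_one_left (abs_nonneg _) (ha i)
  have k1 := (abs_le.1 (key ν)).2
  have k2 := (abs_le.1 (key ν')).1
  linarith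

end Partition

/-! ### Tightness, Cauchy property in `L^1`, and uniformity in time -/

section Compactness

variable {d : ℕ}

/-- Uniform tightness of sets with bounded second moments along a partition. -/
theorem exists_measureReal_compl_le {Q : ℕ → Set (EuclideanSpace ℝ (Fin d))}
    (hQ : ∀ i, MeasurableSet (Q i)) (hdisj : Pairwise fun i j => Disjoint (Q i) (Q j))
    (hcover : ⋃ i, Q i = Set.univ) {M : ℝ≥0∞} (hM : M ≠ ∞) {ε : ℝ} (hε : 0 < ε) :
    ∃ I : ℕ, ∀ A : Set (EuclideanSpace ℝ (Fin d)), ∫⁻ x in A, ‖x‖ₑ ^ 2 ≤ M →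
      (volume.restrict A).real (⋃ i ∈ Finset.range I, Q i)ᶜ ≤ ε := by
  have hε4 : (0 : ℝ≥0∞) < ENNReal.ofReal (ε / 2) := ENNReal.ofReal_pos.2 (by positivity)
  obtain ⟨R, hR0, hR⟩ : ∃ R : ℝ, 0 < R ∧ M / ENNReal.ofReal (R ^ 2) ≤ ENNReal.ofReal (ε / 2) := by
    -- Chebyshev's inequality with this radius leaves mass at most `ε / 2` outside the ball; the `+
    -- 1` keeps `R` positive when `M = 0`.
    refine ⟨Real.sqrt (M.toReal / (ε / 2) + 1), by positivity, ?_⟩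
    rw [Real.sq_sqrt (by positivity)]
    refine ENNReal.div_le_of_le_mul ?_
    rw [← ENNReal.ofReal_mul (by positivity), ← ENNReal.ofReal_toReal hM]
    refine ENNReal.ofReal_le_ofReal ?_
    rw [ENNReal.toReal_ofReal ENNReal.toReal_nonneg, mul_add, mul_div_cancel₀ _ (by positivity)]
    linarith
  set B : Set (EuclideanSpace ℝ (Fin d)) := Metric.ball 0 R
  have hBfin : IsFiniteMeasure (volume.restrict B) :=
    ⟨by simpa using (Metric.isBounded_ball (x := (0 : EuclideanSpace ℝ (Fin d)))
      (r := R)).measure_lt_top (μ := volume)⟩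
  have hlim := tendsto_measure_biUnion_Ici_zero_of_pairwise_disjoint (μ := volume.restrict B)
    (fun i => (hQ i).nullMeasurableSet) hdisj
  obtain ⟨I, hI⟩ := (hlim.eventually_le_const hε4).exists
  have hsub : (⋃ i ∈ Finset.range I, Q i)ᶜ ⊆ ⋃ i, ⋃ (_ : i ≥ I), Q i := by
    intro x hx
    obtain ⟨i, hi⟩ := Set.mem_iUnion.1 (hcover ▸ Set.mem_univ x)
    simp only [Set.mem_compl_iff, Set.mem_iUnion, Finset.mem_range, not_exists] at hx
    simp only [Set.mem_iUnion]
    exact ⟨i, not_lt.1 fun h => hx i h hi, hi⟩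
  refine ⟨I, fun A hA => ?_⟩
  set U := (⋃ i ∈ Finset.range I, Q i)ᶜ
  have hUm : MeasurableSet U := (Finset.measurableSet_biUnion _ fun i _ => hQ i).compl
  refine ENNReal.toReal_le_of_le_ofReal hε.le ?_
  have h1 : (volume.restrict A) Bᶜ ≤ ENNReal.ofReal (ε / 2) := by
    refine le_trans ?_ hR
    have hmark := meas_ge_le_lintegral_div (μ := volume.restrict A)
      (f := fun x : EuclideanSpace ℝ (Fin d) => ‖x‖ₑ ^ 2) (by fun_prop)
      (ε := ENNReal.ofReal (R ^ 2)) (ENNReal.ofReal_pos.2 (by positivity)).ne' ENNReal.ofReal_ne_top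
    refine le_trans (measure_mono fun x hx => ?_) (hmark.trans (ENNReal.div_le_div_right hA _))
    have hx' : R ≤ ‖x‖ := by simpa [B] using hx
    rw [Set.mem_ofPred_eq, ← ofReal_norm, ← ENNReal.ofReal_pow (norm_nonneg _)]
    exact ENNReal.ofReal_le_ofReal (pow_le_pow_left₀ hR0.le hx' 2)
  have h2 : (volume.restrict A) (U ∩ B) ≤ ENNReal.ofReal (ε / 2) := by
    refine (Measure.restrict_apply_le _ _).trans ?_
    rw [← Measure.restrict_apply hUm]
    exact (measure_mono hsub).trans hI
  calc (volume.restrict A) U ≤ (volume.restrict A) (U ∩ B ∪ Bᶜ) := measure_mono fun x hx => by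
        by_cases hxB : x ∈ B
        · exact Or.inl ⟨hx, hxB⟩
        · exact Or.inr hxB
    _ ≤ ENNReal.ofReal (ε / 2) + ENNReal.ofReal (ε / 2) :=
        (measure_union_le _ _).trans (add_le_add h2 h1)
    _ = ENNReal.ofReal ε := by
        rw [← ENNReal.ofReal_add (by positivity) (by positivity), add_halves]

/-- Sets of bounded volume, perimeter and second moment whose volume fractions in the pieces of
arbitrarily fine partitions converge form a Cauchy sequence in `L^1`. -/
theorem cauchy_symmDiff_of_tendsto_partition {Q : ℕ → ℕ → Set (EuclideanSpace ℝ (Fin d))}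
    (hQ : ∀ m i, MeasurableSet (Q m i)) (hdisj : ∀ m, Pairwise fun i j => Disjoint (Q m i) (Q m j))
    (hcover : ∀ m, ⋃ i, Q m i = Set.univ)
    (hdiam : ∀ m i, ∀ x ∈ Q m i, ∀ y ∈ Q m i, ‖x - y‖ ≤ 1 / ((m : ℝ) + 1))
    {A : ℕ → Set (EuclideanSpace ℝ (Fin d))} (hA : ∀ n, NullMeasurableSet (A n))
    {v P M : ℝ≥0∞} (hv : v ≠ ∞) (hP : P ≠ ∞) (hM : M ≠ ∞) (hvA : ∀ n, volume (A n) ≤ v)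
    (hPA : ∀ n, perimeter (A n) ≤ P) (hMA : ∀ n, ∫⁻ x in A n, ‖x‖ₑ ^ 2 ≤ M)
    (hlim : ∀ m i, ∃ a, Tendsto (fun n => volume (Q m i ∩ A n)) atTop (𝓝 a))
    (ε : ℝ≥0∞) (hε : 0 < ε) : ∃ N, ∀ i ≥ N, ∀ j ≥ N, volume (A i ∆ A j) ≤ ε := by
  obtain ⟨φ, L, hφ⟩ := exists_isMollifier d
  have hL := hφ.pos
  obtain ⟨e, he0, he⟩ : ∃ e : ℝ, 0 < e ∧ ENNReal.ofReal e ≤ ε := by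
    rcases eq_or_ne ε ∞ with rfl | hε'
    · exact ⟨1, one_pos, le_top⟩
    · exact ⟨ε.toReal, ENNReal.toReal_pos hε.ne' hε', ENNReal.ofReal_toReal_le⟩
  have hAfin : ∀ n, volume (A n) ≠ ∞ := fun n => ne_top_of_le_ne_top hv (hvA n)
  have hfinm : ∀ n, IsFiniteMeasure (volume.restrict (A n)) := fun n =>
    ⟨by simpa using (hAfin n).lt_top⟩
  -- The error `e` is split into four quarters: mollification, oscillation of the Lipschitz test
  -- function on cells, mismatch of finitely many cell volumes, and the two tails of `e / 8`.
  set r : ℝ := e / (8 * (P.toReal + 1)) with hr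
  have hr0 : 0 < r := by positivity
  have hrP : 2 * r * P.toReal ≤ e / 4 := by
    rw [hr, mul_div_assoc', div_mul_eq_mul_div, div_le_div_iff₀ (by positivity) (by positivity)]
    nlinarith [ENNReal.toReal_nonneg (a := P)]
  obtain ⟨m, hm⟩ := exists_nat_gt (8 * (L / r) * (v.toReal + 1) / e)
  set c : ℝ := L / r * (1 / ((m : ℝ) + 1)) with hc
  have hc0 : 0 ≤ c := by positivity
  have hcv : c * (v.toReal + v.toReal) ≤ e / 4 := by
    rw [div_lt_iff₀ he0] at hm
    rw [hc, mul_one_div, div_mul_eq_mul_div, div_le_div_iff₀ (by positivity) (by positivity)]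
    have h1 : 0 < L / r := by positivity
    nlinarith
  obtain ⟨I, hI⟩ := exists_measureReal_compl_le (hQ m) (hdisj m) (hcover m) hM
    (ε := e / 8) (by positivity)
  have hcauchy : ∀ i : ℕ, ∃ N, ∀ n ≥ N, ∀ n' ≥ N,
      |(volume.restrict (A n)).real (Q m i) - (volume.restrict (A n')).real (Q m i)|
        ≤ e / (4 * ((I : ℝ) + 1)) := by
    intro i
    obtain ⟨a, ha⟩ := hlim m i
    have hafin : a ≠ ∞ := ne_top_of_le_ne_top hv
      (le_of_tendsto' ha fun n => (measure_mono Set.inter_subset_right).trans (hvA n))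
    have hreal := ((ENNReal.tendsto_toReal hafin).comp ha).cauchySeq
    rw [Metric.cauchySeq_iff] at hreal
    obtain ⟨N, hN⟩ := hreal (e / (4 * ((I : ℝ) + 1))) (by positivity)
    refine ⟨N, fun n hn n' hn' => ?_⟩
    have := (hN n hn n' hn').le
    rw [Real.dist_eq] at this
    simpa only [Measure.real, Measure.restrict_apply (hQ m i), Function.comp_apply] using this
  choose N hN using hcauchy
  refine ⟨(Finset.range I).sup N, fun n hn n' hn' => le_trans ?_ he⟩
  refine (hφ.measure_symmDiff_le (hA n) (hA n') (hAfin n) (hAfin n') hP (hPA n) (hPA n') hr0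
    (B := 3 * (e / 4)) fun g hg1 hg => ?_).trans (ENNReal.ofReal_le_ofReal (by linarith))
  have hcont : Continuous g := by
    refine (LipschitzWith.of_dist_le_mul (K := ⟨L / r, by positivity⟩) fun x y => ?_).continuous
    rw [Real.dist_eq, dist_eq_norm]
    exact hg x y
  have hpt : ∀ i, ∃ a : ℝ, |a| ≤ 1 ∧ ∀ y ∈ Q m i, |g y - a| ≤ c := by
    intro i
    rcases (Q m i).eq_empty_or_nonempty with h0 | ⟨x, hx⟩
    · exact ⟨0, by simp, by simp [h0]⟩
    · refine ⟨g x, hg1 x, fun y hy => (hg y x).trans ?_⟩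
      exact mul_le_mul_of_nonneg_left (hdiam m i y hy x hx) (by positivity)
  choose a ha1 ha using hpt
  have hmain := integral_sub_integral_le_of_partition (ν := volume.restrict (A n))
    (ν' := volume.restrict (A n')) (hQ m) (hdisj m) I hcont.measurable hg1 hc0 ha1 ha
  have hvol : ∀ n, (volume.restrict (A n)).real Set.univ ≤ v.toReal := fun n => by
    rw [Measure.real, Measure.restrict_apply_univ]
    exact ENNReal.toReal_mono hv (hvA n)
  have h1 : c * ((volume.restrict (A n)).real Set.univ + (volume.restrict (A n')).real Set.univ) ≤
      e / 4 := (mul_le_mul_of_nonneg_left (add_le_add (hvol n) (hvol n')) hc0).trans hcv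
  have h2 : ∑ i ∈ Finset.range I,
      |(volume.restrict (A n)).real (Q m i) - (volume.restrict (A n')).real (Q m i)| ≤ e / 4 := by
    refine (Finset.sum_le_card_nsmul _ _ _ fun i hi =>
      hN i n ((Finset.le_sup hi).trans hn) n' ((Finset.le_sup hi).trans hn')).trans ?_
    rw [Finset.card_range, nsmul_eq_mul, mul_div_assoc', div_le_div_iff₀ (by positivity)
      (by positivity)]
    nlinarith
  linarith [hI (A n) (hMA n), hI (A n') (hMA n')]

/-- A sequence of families of measurable partitions of vanishing diameter. -/
theorem exists_fine_partitions (d : ℕ) : ∃ Q : ℕ → ℕ → Set (EuclideanSpace ℝ (Fin d)),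
    (∀ m i, MeasurableSet (Q m i)) ∧ (∀ m, Pairwise fun i j => Disjoint (Q m i) (Q m j)) ∧
    (∀ m, ⋃ i, Q m i = Set.univ) ∧
    ∀ m i, ∀ x ∈ Q m i, ∀ y ∈ Q m i, ‖x - y‖ ≤ 1 / ((m : ℝ) + 1) := by
  choose Q h1 h2 h3 h4 h5 using fun m : ℕ =>
    SeparableSpace.exists_measurable_partition_diam_le (EuclideanSpace ℝ (Fin d))
      (ε := 1 / ((m : ℝ) + 1)) (by positivity)
  refine ⟨Q, h1, h5, h4, fun m i x hx y hy => ?_⟩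
  rw [← dist_eq_norm]
  exact (Metric.dist_le_diam_of_mem (h2 m i) hx hy).trans (h3 m i)

/-- Equicontinuity up to a vanishing error and the Cauchy property at rational times give the
Cauchy property locally uniformly in time. -/
theorem uniform_cauchy_of_rat {V : Type*} [MeasurableSpace V] {μ : Measure V}
    {F : ℕ → ℝ → Set V} {h : ℕ → ℝ} (hh : Tendsto h atTop (𝓝 0)) {K : ℝ≥0∞} (hK : K ≠ ∞) {a : ℝ}
    (ha : 0 < a)
    (hF : ∀ n s t, 0 ≤ s → s ≤ t → μ (F n t ∆ F n s) ≤ K * ENNReal.ofReal (t - s + h n) ^ a)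
    (hrat : ∀ q : ℚ, ∀ ε : ℝ≥0∞, 0 < ε → ∃ N, ∀ i ≥ N, ∀ j ≥ N, μ (F i |q| ∆ F j |q|) ≤ ε)
    {T : ℝ} {ε : ℝ≥0∞} (hε : 0 < ε) :
    ∃ N, ∀ i ≥ N, ∀ j ≥ N, ∀ t ∈ Set.Icc 0 T, μ (F i t ∆ F j t) ≤ ε := by
  have hε3 : 0 < ε / 3 := ENNReal.div_pos hε.ne' (by simp)
  have hlim : Tendsto (fun x : ℝ => K * ENNReal.ofReal x ^ a) (𝓝 0) (𝓝 0) := by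
    have h1 : Tendsto (fun x : ℝ => ENNReal.ofReal x ^ a) (𝓝 0) (𝓝 0) := by
      have := (ENNReal.continuous_rpow_const (y := a)).comp ENNReal.continuous_ofReal
      simpa [Function.comp_def, ENNReal.zero_rpow_of_pos ha] using this.tendsto 0
    simpa using ENNReal.Tendsto.const_mul h1 (Or.inr hK)
  obtain ⟨δ, hδ, hδK⟩ := Metric.eventually_nhds_iff.1 (hlim.eventually_le_const hε3)
  -- A grid of mesh `q < δ / 2`, together with `h n < δ / 2`, keeps the time gap plus error below
  -- `δ`. Only finitely many grid times lie in `[0, T]`.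
  obtain ⟨q, hq0, hqδ⟩ := exists_rat_btwn (show (0 : ℝ) < δ / 2 by positivity)
  obtain ⟨N₀, hN₀⟩ := eventually_atTop.1
    (hh.eventually (Metric.ball_mem_nhds 0 (show (0 : ℝ) < δ / 2 by positivity)))
  choose N hN using fun n : ℕ => hrat (n * q) (ε / 3) hε3
  refine ⟨max N₀ ((Finset.range (⌊T / q⌋₊ + 1)).sup N), fun i hi j hj t ht => ?_⟩
  set n := ⌊t / q⌋₊ with hn
  have hnT : n ∈ Finset.range (⌊T / q⌋₊ + 1) := by
    rw [Finset.mem_range, Nat.lt_succ_iff]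
    exact Nat.floor_mono (div_le_div_of_nonneg_right ht.2 hq0.le)
  have hs : (n : ℝ) * q ≤ t := by
    rw [← le_div_iff₀ hq0]
    exact Nat.floor_le (div_nonneg ht.1 hq0.le)
  have hts : t - n * q < δ / 2 := by
    have h2 : t / q < n + 1 := Nat.lt_floor_add_one _
    rw [div_lt_iff₀ hq0] at h2
    linarith
  have hs0 : (0 : ℝ) ≤ n * q := by positivity
  have hcast : |(((n : ℚ) * q : ℚ) : ℝ)| = n * q := by
    push_cast
    exact abs_of_nonneg hs0
  have hclose : ∀ i ≥ N₀, μ (F i t ∆ F i (n * q)) ≤ ε / 3 := by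
    intro i hi
    refine (hF i _ t hs0 hs).trans (hδK ?_)
    have h3 := hN₀ i hi
    rw [Real.dist_eq, sub_zero, abs_lt] at h3
    rw [Real.dist_eq, sub_zero, abs_lt]
    constructor <;> linarith [h3.1, h3.2]
  have hmid := hN n i ((Finset.le_sup hnT).trans ((le_max_right _ _).trans hi)) j
    ((Finset.le_sup hnT).trans ((le_max_right _ _).trans hj))
  rw [hcast] at hmid
  calc μ (F i t ∆ F j t) ≤ μ (F i t ∆ F i (n * q)) + μ (F i (n * q) ∆ F j t) :=
        measure_symmDiff_triangle _ _ _
    _ ≤ μ (F i t ∆ F i (n * q)) + (μ (F i (n * q) ∆ F j (n * q)) + μ (F j (n * q) ∆ F j t)) :=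
        add_le_add_right (measure_symmDiff_triangle _ _ _) _
    _ ≤ ε / 3 + (ε / 3 + ε / 3) := by
        refine add_le_add (hclose i ((le_max_left _ _).trans hi)) (add_le_add hmid ?_)
        rw [symmDiff_comm]
        exact hclose j ((le_max_left _ _).trans hj)
    _ = ε := by rw [← add_assoc, ENNReal.add_thirds]

end Compactness

/-! ### Extraction of the limit flow -/

section Limit

variable {d : ℕ}

theorem tendsto_const_mul_ofReal_add_rpow {K : ℝ≥0∞} (hK : K ≠ ∞) {a : ℝ} {h : ℕ → ℝ}
    (hh : Tendsto h atTop (𝓝 0)) (x : ℝ) :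
    Tendsto (fun n => K * ENNReal.ofReal (x + h n) ^ a) atTop (𝓝 (K * ENNReal.ofReal x ^ a)) := by
  have h1 : Tendsto (fun n => x + h n) atTop (𝓝 x) := by simpa using hh.const_add x
  have h2 := (ENNReal.continuous_rpow_const (y := a)).comp ENNReal.continuous_ofReal
  exact ENNReal.Tendsto.const_mul ((h2.tendsto x).comp h1) (Or.inr hK)

theorem volume_eq_of_tendsto_symmDiff {V : Type*} [MeasurableSpace V] {μ : Measure V}
    {A : ℕ → Set V} {B : Set V} (hAB : Tendsto (fun n => μ (A n ∆ B)) atTop (𝓝 0))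
    {v : ℝ≥0∞} (hv : ∀ n, μ (A n) = v) : μ B = v := by
  have key : ∀ S T : Set V, μ S ≤ μ T + μ (S ∆ T) := fun S T =>
    (measure_mono fun x hx => by
      by_cases hxT : x ∈ T
      · exact Or.inl hxT
      · exact Or.inr (Or.inl ⟨hx, hxT⟩)).trans (measure_union_le T (S ∆ T))
  refine le_antisymm ?_ ?_
  · have h1 : Tendsto (fun n => v + μ (A n ∆ B)) atTop (𝓝 v) := by simpa using hAB.const_add v
    refine ge_of_tendsto' h1 fun n => ?_
    rw [← hv n, symmDiff_comm]
    exact key _ _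
  · have h1 : Tendsto (fun n => μ B + μ (A n ∆ B)) atTop (𝓝 (μ B)) := by
      simpa using hAB.const_add (μ B)
    refine ge_of_tendsto' h1 fun n => ?_
    rw [← hv n]
    exact key _ _

/-- Sequential compactness of a countable power of `[0, ∞]`, in place of a diagonal argument. -/
theorem exists_subseq_tendsto_partition {ι : Type*} [Countable ι] (f : ℕ → ι → ℝ≥0∞) :
    ∃ φ : ℕ → ℕ, StrictMono φ ∧ ∀ i, ∃ a, Tendsto (fun n => f (φ n) i) atTop (𝓝 a) := by
  obtain ⟨a, φ, hφ, ha⟩ := CompactSpace.tendsto_subseq f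
  exact ⟨φ, hφ, fun i => ⟨a i, (tendsto_pi_nhds.1 ha) i⟩⟩

/-- The second moments of a discrete solution grow at most linearly in time. -/
theorem IsMinimizingMovement.secondMoment_le {k : EuclideanSpace ℝ (Fin d) → ℝ}
    {E₀ : Set (EuclideanSpace ℝ (Fin d))} {h : ℝ} {E : ℕ → Set (EuclideanSpace ℝ (Fin d))}
    (hE : IsMinimizingMovement k h E₀ E) (hh : 0 < h) (hk : IsKernel k)
    (hE₀ : IsInitialCondition E₀) {t : ℝ} (ht : 0 ≤ t) :
    ∫⁻ x in interpolate h E t, ‖x‖ₑ ^ 2 ≤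
      2 * (∫⁻ x in E₀, ‖x‖ₑ ^ 2) + 2 * (ENNReal.ofReal (2 * t) * energy k E₀) := by
  refine (lintegral_enorm_sq_le _ E₀).trans ?_
  have h1 := hE.W2sq_le hh hk hE₀ 0 ⌊t / h⌋₊
  rw [zero_add, hE.init] at h1
  have h2 : (⌊t / h⌋₊ : ℝ) * h ≤ t := by
    rw [← le_div_iff₀ hh]
    exact Nat.floor_le (by positivity)
  have h3 : W2sq (interpolate h E t) E₀ ≤ ENNReal.ofReal (2 * t) * energy k E₀ := by
    refine h1.trans ?_
    gcongr
  gcongr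

theorem exists_limit_of_minimizingMovements {k : EuclideanSpace ℝ (Fin d) → ℝ} (hk : IsKernel k)
    {E₀ : Set (EuclideanSpace ℝ (Fin d))} (hE₀ : IsInitialCondition E₀) {K : ℝ≥0∞} (hK : K ≠ ∞)
    {h : ℕ → ℝ} (hpos : ∀ j, 0 < h j) (hh : Tendsto h atTop (𝓝 0))
    {E : ℕ → ℕ → Set (EuclideanSpace ℝ (Fin d))}
    (hE : ∀ j, IsMinimizingMovement k (h j) E₀ (E j))
    (hvol : ∀ j s t, 0 ≤ s → s ≤ t →
      volume (interpolate (h j) (E j) t ∆ interpolate (h j) (E j) s) ≤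
        K * ENNReal.ofReal (t - s + h j) ^ (1 / 4 : ℝ)) :
    ∃ φ : ℕ → ℕ, StrictMono φ ∧ ∃ Elim : ℝ → Set (EuclideanSpace ℝ (Fin d)),
      (∀ t, MeasurableSet (Elim t)) ∧
      (∀ T : ℝ, Tendsto (fun j => ⨆ t ∈ Set.Icc (0 : ℝ) T,
        volume (interpolate (h (φ j)) (E (φ j)) t ∆ Elim t)) atTop (𝓝 0)) := by
  obtain ⟨Q, hQ, hdisj, hcover, hdiam⟩ := exists_fine_partitions d
  -- One extraction covers every mesh, cell and rational time; `|q|` makes the times nonnegative.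
  obtain ⟨φ, hφ, hlim⟩ := exists_subseq_tendsto_partition
    (fun (j : ℕ) (p : ℕ × ℕ × ℚ) => volume (Q p.1 p.2.1 ∩ interpolate (h j) (E j) |p.2.2|))
  have hhφ : Tendsto (h ∘ φ) atTop (𝓝 0) := hh.comp hφ.tendsto_atTop
  set F : ℕ → ℝ → Set (EuclideanSpace ℝ (Fin d)) := fun j t => interpolate (h (φ j)) (E (φ j)) t
  have hFm : ∀ j t, NullMeasurableSet (F j t) := fun j t => (hE (φ j)).measurable _
  have hrat : ∀ q : ℚ, ∀ ε : ℝ≥0∞, 0 < ε →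
      ∃ N, ∀ i ≥ N, ∀ j ≥ N, volume (F i |q| ∆ F j |q|) ≤ ε := by
    intro q
    have he := hE₀.energy_ne_top hk
    have hm := hE₀.secondMoment_ne_top
    have hM : 2 * (∫⁻ x in E₀, ‖x‖ₑ ^ 2) + 2 * (ENNReal.ofReal (2 * |(q : ℝ)|) * energy k E₀) ≠ ∞ := by
      finiteness
    have hFv : ∀ n, volume (F n |(q : ℝ)|) ≤ volume E₀ := fun n =>
      ((hE (φ n)).volume_energy hk hE₀ _).1.le
    have hFP : ∀ n, perimeter (F n |(q : ℝ)|) ≤ energy k E₀ := fun n =>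
      (perimeter_le_energy k _).trans ((hE (φ n)).volume_energy hk hE₀ _).2
    have hFM : ∀ n, ∫⁻ x in F n |(q : ℝ)|, ‖x‖ₑ ^ 2 ≤
        2 * (∫⁻ x in E₀, ‖x‖ₑ ^ 2) + 2 * (ENNReal.ofReal (2 * |(q : ℝ)|) * energy k E₀) :=
      fun n => (hE (φ n)).secondMoment_le (hpos _) hk hE₀ (abs_nonneg _)
    have hFlim : ∀ m i, ∃ a, Tendsto (fun n => volume (Q m i ∩ F n |(q : ℝ)|)) atTop (𝓝 a) :=
      fun m i => hlim (m, i, q)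
    exact cauchy_symmDiff_of_tendsto_partition hQ hdisj hcover hdiam (fun n => hFm n _)
      hE₀.volume_ne_top he hM hFv hFP hFM hFlim
  have huc : ∀ T : ℝ, ∀ ε : ℝ≥0∞, 0 < ε →
      ∃ N, ∀ i ≥ N, ∀ j ≥ N, ∀ t ∈ Set.Icc 0 T, volume (F i t ∆ F j t) ≤ ε := fun T ε hε =>
    uniform_cauchy_of_rat hhφ hK (by norm_num) (fun n s t hs hst => hvol (φ n) s t hs hst) hrat hε
  have hex : ∀ t : ℝ, ∃ B : Set (EuclideanSpace ℝ (Fin d)), MeasurableSet B ∧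
      (0 ≤ t → Tendsto (fun j => volume (F j t ∆ B)) atTop (𝓝 0)) := by
    intro t
    rcases lt_or_ge t 0 with ht | ht
    · exact ⟨∅, MeasurableSet.empty, fun h0 => absurd h0 ht.not_ge⟩
    · obtain ⟨B, hB, hlimB⟩ := exists_tendsto_measure_symmDiff (fun n => hFm n t) fun ε hε => by
        obtain ⟨N, hN⟩ := huc t ε hε
        exact ⟨N, fun i hi j hj => hN i hi j hj t ⟨ht, le_rfl⟩⟩
      exact ⟨B, hB, fun _ => hlimB⟩
  choose Elim hElim hElimlim using hex
  refine ⟨φ, hφ, Elim, hElim, fun T => ?_⟩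
  rw [ENNReal.tendsto_atTop_zero]
  intro ε hε
  obtain ⟨N, hN⟩ := huc T ε hε
  refine ⟨N, fun j hj => iSup₂_le fun t ht => ?_⟩
  -- Letting `i → ∞` in the uniform Cauchy bound transfers it to the pointwise limit.
  have h1 : Tendsto (fun i => ε + volume (F i t ∆ Elim t)) atTop (𝓝 ε) := by
    simpa using (hElimlim t ht.1).const_add ε
  refine ge_of_tendsto h1 ?_
  filter_upwards [eventually_ge_atTop N] with i hi
  exact (measure_symmDiff_triangle _ (F i t) _).trans
    (add_le_add_left (hN j hj i hi t ht) _)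

end Limit

end FerroFlow

/-! ### The compactness lemma -/

theorem mainTheorem2 (d : ℕ) (hd : 1 ≤ d) :
    ∃ C : ℝ, 0 < C ∧
      ∀ (k : EuclideanSpace ℝ (Fin d) → ℝ), FerroFlow.IsKernel k →
      ∀ (E₀ : Set (EuclideanSpace ℝ (Fin d))), FerroFlow.IsInitialCondition E₀ →
        -- the estimates for the discrete solutions
        (∀ (h : ℝ), 0 < h →
          ∀ (E : ℕ → Set (EuclideanSpace ℝ (Fin d))),
            FerroFlow.IsMinimizingMovement k h E₀ E →
          ∀ s t : ℝ, 0 ≤ s → s < t → h ≤ t - s →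
            FerroFlow.W2 (FerroFlow.interpolate h E t) (FerroFlow.interpolate h E s)
                ≤ ENNReal.ofReal C * FerroFlow.energy k E₀ ^ (1 / 2 : ℝ)
                  * ENNReal.ofReal (t - s) ^ (1 / 2 : ℝ) ∧
            volume (FerroFlow.interpolate h E t ∆ FerroFlow.interpolate h E s)
                ≤ ENNReal.ofReal C * volume E₀ ^ (1 / 4 : ℝ)
                  * FerroFlow.energy k E₀ ^ (3 / 4 : ℝ)
                  * ENNReal.ofReal (t - s) ^ (1 / 4 : ℝ)) ∧
        -- compactness, and the estimates for the limit
        (∀ (h : ℕ → ℝ), (∀ j, 0 < h j) → Tendsto h atTop (𝓝 0) →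
          ∀ (E : ℕ → ℕ → Set (EuclideanSpace ℝ (Fin d))),
            (∀ j, FerroFlow.IsMinimizingMovement k (h j) E₀ (E j)) →
          ∃ φ : ℕ → ℕ, StrictMono φ ∧
          ∃ Elim : ℝ → Set (EuclideanSpace ℝ (Fin d)),
            (∀ t : ℝ, 0 ≤ t → FerroFlow.HasFinitePerimeter (Elim t)) ∧
            (∀ T : ℝ, 0 ≤ T →
              Tendsto (fun j => ⨆ t ∈ Set.Icc (0 : ℝ) T,
                  volume (FerroFlow.interpolate (h (φ j)) (E (φ j)) t ∆ Elim t))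
                atTop (𝓝 0)) ∧
            (∀ s t : ℝ, 0 ≤ s → s < t →
              FerroFlow.W2 (Elim t) (Elim s)
                  ≤ ENNReal.ofReal C * FerroFlow.energy k E₀ ^ (1 / 2 : ℝ)
                    * ENNReal.ofReal (t - s) ^ (1 / 2 : ℝ) ∧
              volume (Elim t ∆ Elim s)
                  ≤ ENNReal.ofReal C * volume E₀ ^ (1 / 4 : ℝ)
                    * FerroFlow.energy k E₀ ^ (3 / 4 : ℝ)
                    * ENNReal.ofReal (t - s) ^ (1 / 4 : ℝ))) := by
  obtain ⟨C, hC, hdisc⟩ := FerroFlow.exists_discrete_estimate d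
  -- The doubling absorbs the extra time step: `t - s + h ≤ 2 (t - s)` when `h ≤ t - s`, and `2 ^ a
  -- ≤ 2` for `a ≤ 1`.
  refine ⟨2 * C, by positivity, fun k hk E₀ hE₀ => ⟨?_, ?_⟩⟩
  · intro h hh E hE s t hs hst hhst
    obtain ⟨h1, h2⟩ := hdisc k hk E₀ hE₀ h hh E hE s t hs hst.le
    have hdouble : ∀ a : ℝ, 0 < a → a ≤ 1 →
        ENNReal.ofReal (t - s + h) ^ a ≤ 2 * ENNReal.ofReal (t - s) ^ a := by
      intro a ha ha1
      calc ENNReal.ofReal (t - s + h) ^ a ≤ ENNReal.ofReal (2 * (t - s)) ^ a := by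
            gcongr
            linarith
        _ = 2 ^ a * ENNReal.ofReal (t - s) ^ a := by
            rw [ENNReal.ofReal_mul zero_le_two, ENNReal.mul_rpow_of_nonneg _ _ ha.le,
              ENNReal.ofReal_ofNat]
        _ ≤ 2 * ENNReal.ofReal (t - s) ^ a := by
            gcongr
            simpa using ENNReal.rpow_le_rpow_of_exponent_le (x := 2) (by norm_num) ha1
    rw [ENNReal.ofReal_mul zero_le_two, ENNReal.ofReal_ofNat]
    constructor
    · refine (h1.trans (mul_le_mul_right (hdouble _ (by norm_num) (by norm_num)) _)).trans_eq ?_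
      ring
    · refine (h2.trans (mul_le_mul_right (hdouble _ (by norm_num) (by norm_num)) _)).trans_eq ?_
      ring
  · intro h hpos hh E hE
    have he := hE₀.energy_ne_top hk
    have hv := hE₀.volume_ne_top
    have hm := hE₀.secondMoment_ne_top
    set K₁ := ENNReal.ofReal C * FerroFlow.energy k E₀ ^ (1 / 2 : ℝ) with hK₁
    set K₂ := ENNReal.ofReal C * volume E₀ ^ (1 / 4 : ℝ) * FerroFlow.energy k E₀ ^ (3 / 4 : ℝ)
      with hK₂
    have hK₁fin : K₁ ≠ ∞ := by finiteness
    have hK₂fin : K₂ ≠ ∞ := by finiteness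
    have hCC : ENNReal.ofReal C ≤ ENNReal.ofReal (2 * C) := ENNReal.ofReal_le_ofReal (by linarith)
    have hdisc' := fun j => hdisc k hk E₀ hE₀ (h j) (hpos j) (E j) (hE j)
    obtain ⟨φ, hφ, Elim, hElim, hunif⟩ := FerroFlow.exists_limit_of_minimizingMovements hk hE₀
      hK₂fin hpos hh hE (fun j s t hs hst => (hdisc' j s t hs hst).2)
    have hhφ : Tendsto (fun j => h (φ j)) atTop (𝓝 0) := hh.comp hφ.tendsto_atTop
    set F : ℕ → ℝ → Set (EuclideanSpace ℝ (Fin d)) :=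
      fun j t => FerroFlow.interpolate (h (φ j)) (E (φ j)) t with hF
    have hpt : ∀ t, 0 ≤ t → Tendsto (fun j => volume (F j t ∆ Elim t)) atTop (𝓝 0) := fun t ht =>
      tendsto_of_tendsto_of_tendsto_of_le_of_le tendsto_const_nhds (hunif t) (fun j => bot_le)
        fun j => le_iSup₂_of_le t ⟨ht, le_rfl⟩ le_rfl
    have hFm : ∀ j t, NullMeasurableSet (F j t) volume := fun j t => (hE (φ j)).measurable _
    have hFv : ∀ j t, volume (F j t) = volume E₀ := fun j t =>
      ((hE (φ j)).volume_energy hk hE₀ _).1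
    have hElimv : ∀ t, 0 ≤ t → volume (Elim t) = volume E₀ := fun t ht =>
      FerroFlow.volume_eq_of_tendsto_symmDiff (hpt t ht) (fun j => hFv j t)
    -- Finite second moments of the limit sets are what the lower semicontinuity of `W_2` requires.
    have hElimm : ∀ t, 0 ≤ t → ∫⁻ x in Elim t, ‖x‖ₑ ^ 2 ≠ ∞ := fun t ht => by
      refine ne_top_of_le_ne_top ?_ (FerroFlow.setLIntegral_le_of_tendsto_symmDiff (hpt t ht)
        (by fun_prop) fun j => (hE (φ j)).secondMoment_le (hpos _) hk hE₀ ht)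
      finiteness
    refine ⟨φ, hφ, Elim, fun t ht => ⟨(hElim t).nullMeasurableSet, ?_⟩, fun T _ => hunif T, ?_⟩
    · refine lt_of_le_of_lt (FerroFlow.perimeter_le_of_tendsto_symmDiff (fun j => hFm j t)
        (hElim t).nullMeasurableSet (hpt t ht) fun j => ?_) he.lt_top
      exact (FerroFlow.perimeter_le_energy k _).trans ((hE (φ j)).volume_energy hk hE₀ _).2
    · intro s t hs hst
      have ht : 0 ≤ t := hs.trans hst.le
      constructor
      -- Lower semicontinuity is applied to the squared distance, with bounds in which `h (φ j) → 0`
      -- removes the extra step.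
      · have hlim := (ENNReal.continuous_rpow_const (y := 2)).tendsto _ |>.comp
          (FerroFlow.tendsto_const_mul_ofReal_add_rpow hK₁fin (a := 1 / 2) hhφ (t - s))
        have hW := FerroFlow.W2sq_le_of_tendsto_symmDiff (hElim t) (hElim s) (hpt t ht) (hpt s hs)
          (fun j => (hFv j t).trans (hElimv t ht).symm)
          (fun j => (hFv j s).trans (hElimv s hs).symm) (hElimm t ht) (hElimm s hs) hlim
          (Eventually.of_forall fun j => by
            rw [← FerroFlow.W2_rpow_two]
            exact ENNReal.rpow_le_rpow (hdisc' (φ j) s t hs hst.le).1 (by norm_num))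
        have hW2 := ENNReal.rpow_le_rpow hW (z := 1 / 2) (by norm_num)
        rw [← ENNReal.rpow_mul] at hW2
        norm_num only at hW2
        rw [ENNReal.rpow_one] at hW2
        refine le_trans hW2 ?_
        rw [hK₁]
        gcongr
      · have hlim := FerroFlow.tendsto_const_mul_ofReal_add_rpow hK₂fin (a := 1 / 4) hhφ (t - s)
        have hsum := ((hpt t ht).add hlim).add (hpt s hs)
        rw [zero_add, add_zero] at hsum
        refine (ge_of_tendsto' hsum fun j => ?_).trans (by rw [hK₂]; gcongr)
        refine (FerroFlow.measure_symmDiff_triangle _ (F j s) _).trans (add_le_add_left ?_ _)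
        refine (FerroFlow.measure_symmDiff_triangle _ (F j t) _).trans ?_
        rw [symmDiff_comm (Elim t)]
        exact add_le_add_right (hdisc' (φ j) s t hs hst.le).2 _
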